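/- All tensor products of $C^*$-algebras are minimal (spatial), and $M(\cdot)$ denotes the multiplier algebra. A *locally compact quantum group* $\mathbb{G}$ (in the sense of Kustermans and Vaes) consists of a $C^*$-algebra $C=C_0(\mathbb{G})$ and a nondegenerate $*$-homomorphism $\Delta:C\to M(C\otimes C)$ with $(\Delta\otimes\mathrm{id})\Delta=(\mathrm{id}\otimes\Delta)\Delta$, such that the elements $(\omega\otimes\mathrm{id})\Delta(a)$, respectively $(\mathrm{id}\otimes\omega)\Delta(a)$, with $\omega\in C^*$ and $a\in C$, lie in $C$ and span a dense subspace of it, and such that $C$ has a faithful left-invariant approximate KMS weight and a right-invariant approximate KMS weight. (A weight is *approximate KMS* if it is nonzero, lower semicontinuous and densely defined and its $W^*$-lift to the von Neumann algebra of its GNS representation is faithful.) An *action* of $\mathbb{G}$ on a unital $C^*$-algebra $A$ is a nondegenerate $*$-homomorphism $\rho:A\to M(C\otimes A)$ with $(\mathrm{id}\otimes\rho)\rho=(\Delta\otimes\mathrm{id})\rho$ such that $\rho(A)(C\otimes 1)$ has closed linear span equal to $C\otimes A$. A unital $*$-homomorphism $f:A\to B$ between algebras with actions $\rho_A,\rho_B$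 is *equivariant* if $\rho_B\circ f=(\mathrm{id}\otimes f)\circ\rho_A$, where $\mathrm{id}\otimes f$ is extended strictly to $M(C\otimes A)\to M(C\otimes B)$. Let $\mathcal{C}^{*\mathbb{G}}_1$ be the category of unital $C^*$-algebras with a $\mathbb{G}$-action and equivariant unital $*$-homomorphisms. **Proposition.** Let $\mathbb{G}$ be a locally compact quantum group. Then the classes $\mathcal{E}$ of surjective and $\mathcal{M}$ of injective morphisms form a factorization system on $\mathcal{C}^{*\mathbb{G}}_1$: (1) $\mathcal{E}$ and $\mathcal{M}$ are closed under composition; (2) both contain all isomorphisms; (3) every morphism $f$ can be written as $f=m\circ e$ with $e\in\mathcal{E}$ and $m\in\mathcal{M}$, and for any two such factorizations $m_1\circ e_1=m_2\circ e_2$ there is a unique isomorphism $h$ with $h\circ e_1=e_2$ and $m_2\circ h=m_1$. Moreover, for every morphism $f:A\to B$ the image $f(A)$ is a closed $*$-subalgebra of $B$ and carries a unique action of $\mathbb{G}$ for which both $f:A\to f(A)$ and the inclusion $f(A)\hookrightarrow B$ are equivariant. -/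

import Mathlib

set_option linter.unusedSectionVars false

open scoped TensorProduct MultiplierAlgebra InnerProductSpace
open UniformSpace

universe u

noncomputable section

namespace QG

section TensorStar

variable {A B : Type u} [NonUnitalRing A] [StarRing A] [Module ℂ A] [StarModule ℂ A]
  [IsScalarTower ℂ A A] [SMulCommClass ℂ A A]
  [NonUnitalRing B] [StarRing B] [Module ℂ B] [StarModule ℂ B]
  [IsScalarTower ℂ B B] [SMulCommClass ℂ B B]

instance tensorStarRing : StarRing (A ⊗[ℂ] B) where
  star_mul x y := by
    induction x with
    | zero => simp
    | add x₁ x₂ h₁ h₂ => simp [add_mul, mul_add, h₁, h₂]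
    | tmul a b =>
      induction y with
      | zero => simp
      | add y₁ y₂ h₁ h₂ => simp [add_mul, mul_add, h₁, h₂]
      | tmul c d => simp
  star_add := star_add

/-- Two linear maps intertwining products and adjoints on elementary tensors. -/
def liftStarHom {D : Type u} [NonUnitalRing D] [StarRing D] [Module ℂ D] [StarModule ℂ D]
    [IsScalarTower ℂ D D] [SMulCommClass ℂ D D]
    (Φ : A →ₗ[ℂ] B →ₗ[ℂ] D) (hmul : ∀ a a' b b', Φ (a * a') (b * b') = Φ a b * Φ a' b')
    (hstar : ∀ a b, Φ (star a) (star b) = star (Φ a b)) : (A ⊗[ℂ] B) →⋆ₙₐ[ℂ] D where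
  toFun := TensorProduct.lift Φ
  map_smul' := by simp
  map_zero' := by simp
  map_add' := by simp
  map_mul' x y := by
    induction x with
    | zero => simp
    | add x₁ x₂ h₁ h₂ => simp only [add_mul, map_add, h₁, h₂]
    | tmul a b =>
      induction y with
      | zero => simp
      | add y₁ y₂ h₁ h₂ => simp only [mul_add, map_add, h₁, h₂]
      | tmul c d => simp [hmul]
  map_star' x := by
    induction x with
    | zero => simp
    | add x₁ x₂ h₁ h₂ => simp only [star_add, map_add, h₁, h₂]
    | tmul a b => simp [hstar]

@[simp] theorem liftStarHom_tmul {D : Type u} [NonUnitalRing D] [StarRing D] [Module ℂ D]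
    [StarModule ℂ D] [IsScalarTower ℂ D D] [SMulCommClass ℂ D D]
    (Φ : A →ₗ[ℂ] B →ₗ[ℂ] D) (hmul) (hstar) (a : A) (b : B) :
    liftStarHom Φ hmul hstar (a ⊗ₜ b) = Φ a b := rfl

end TensorStar

/-- A pointwise bounded family of `*`-representations of a complex `*`-algebra on Hilbert
spaces. -/
structure RepFamily (R : Type u) [NonUnitalRing R] [StarRing R] [Module ℂ R] where
  Index : Type (u + 1)
  Space : Index → Type u
  [normed : ∀ i, NormedAddCommGroup (Space i)]
  [inner : ∀ i, InnerProductSpace ℂ (Space i)]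
  [complete : ∀ i, CompleteSpace (Space i)]
  rep : ∀ i, R →⋆ₙₐ[ℂ] (Space i →L[ℂ] Space i)
  bounded : ∀ x, BddAbove (Set.range fun i => ‖rep i x‖)

attribute [instance] RepFamily.normed RepFamily.inner RepFamily.complete

namespace RepFamily

variable {R : Type u} [NonUnitalRing R] [StarRing R] [Module ℂ R]
  [IsScalarTower ℂ R R] [SMulCommClass ℂ R R] [StarModule ℂ R] (F : RepFamily R)

/-- The `*`-algebra `R`, to be equipped with the seminorm `‖x‖ = sup_i ‖rep i x‖`. -/
def Pre (_F : RepFamily R) : Type u := R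

instance : NonUnitalRing F.Pre := inferInstanceAs (NonUnitalRing R)
instance : StarRing F.Pre := inferInstanceAs (StarRing R)
instance : Module ℂ F.Pre := inferInstanceAs (Module ℂ R)
instance : IsScalarTower ℂ F.Pre F.Pre := inferInstanceAs (IsScalarTower ℂ R R)
instance : SMulCommClass ℂ F.Pre F.Pre := inferInstanceAs (SMulCommClass ℂ R R)
instance : StarModule ℂ F.Pre := inferInstanceAs (StarModule ℂ R)

def toPre : R →ₗ[ℂ] F.Pre := LinearMap.id

def preRep (i : F.Index) : F.Pre →⋆ₙₐ[ℂ] (F.Space i →L[ℂ] F.Space i) := F.rep i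

theorem norm_rep_le_iSup (i : F.Index) (x : F.Pre) :
    ‖F.preRep i x‖ ≤ ⨆ j, ‖F.preRep j x‖ := le_ciSup (F.bounded x) i

instance : SeminormedAddCommGroup F.Pre :=
  AddGroupSeminorm.toSeminormedAddCommGroup
    { toFun := fun x => ⨆ i, ‖F.preRep i x‖
      map_zero' := by simp
      add_le' := fun x y => Real.iSup_le (fun i => by
        rw [map_add]
        exact (norm_add_le _ _).trans
          (add_le_add (F.norm_rep_le_iSup i x) (F.norm_rep_le_iSup i y)))
        (add_nonneg (Real.iSup_nonneg fun _ => norm_nonneg _)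
          (Real.iSup_nonneg fun _ => norm_nonneg _))
      neg' := fun x => by simp }

theorem norm_def (x : F.Pre) : ‖x‖ = ⨆ i, ‖F.preRep i x‖ := rfl

theorem norm_preRep_le (i : F.Index) (x : F.Pre) : ‖F.preRep i x‖ ≤ ‖x‖ :=
  F.norm_rep_le_iSup i x

theorem norm_le {x : F.Pre} {M : ℝ} (hM : 0 ≤ M) (h : ∀ i, ‖F.preRep i x‖ ≤ M) : ‖x‖ ≤ M :=
  Real.iSup_le h hM

instance : NormedSpace ℂ F.Pre where
  norm_smul_le c x := F.norm_le (by positivity) fun i => by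
    rw [map_smul, norm_smul]
    exact mul_le_mul_of_nonneg_left (F.norm_preRep_le i x) (norm_nonneg c)

theorem pre_norm_mul_le (x y : F.Pre) : ‖x * y‖ ≤ ‖x‖ * ‖y‖ :=
  F.norm_le (by positivity) fun i => by
    rw [map_mul]
    exact (norm_mul_le _ _).trans (mul_le_mul (F.norm_preRep_le i x) (F.norm_preRep_le i y)
      (norm_nonneg _) (norm_nonneg _))

theorem pre_norm_star (x : F.Pre) : ‖star x‖ = ‖x‖ := by
  simp only [norm_def, map_star, norm_star]

theorem pre_norm_mul_self_le (x : F.Pre) : ‖x‖ * ‖x‖ ≤ ‖star x * x‖ := by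
  have h : ‖x‖ ≤ Real.sqrt ‖star x * x‖ := F.norm_le (Real.sqrt_nonneg _) fun i => by
    apply Real.le_sqrt_of_sq_le
    have := F.norm_preRep_le i (star x * x)
    rwa [map_mul, map_star, CStarRing.norm_star_mul_self, ← sq] at this
  calc ‖x‖ * ‖x‖ ≤ Real.sqrt ‖star x * x‖ * Real.sqrt ‖star x * x‖ := by gcongr
    _ = _ := Real.mul_self_sqrt (norm_nonneg _)

/-- The Hausdorff completion of `R` in the seminorm `‖x‖ = sup_i ‖rep i x‖`. -/
def Envelope : Type u := Completion F.Pre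

namespace Envelope

instance : NormedAddCommGroup F.Envelope := inferInstanceAs (NormedAddCommGroup (Completion F.Pre))
instance : NormedSpace ℂ F.Envelope := inferInstanceAs (NormedSpace ℂ (Completion F.Pre))
instance : CompleteSpace F.Envelope := inferInstanceAs (CompleteSpace (Completion F.Pre))

/-- The canonical map into the completion. -/
def of : F.Pre →ₗᵢ[ℂ] F.Envelope := Completion.toComplₗᵢ

variable {F}

theorem denseRange_of : DenseRange (of F) := Completion.denseRange_coe

theorem induction {p : F.Envelope → Prop} (hc : IsClosed {x | p x}) (h : ∀ a, p (of F a))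
    (x : F.Envelope) : p x := Completion.induction_on x hc h

theorem clm_ext {D : Type*} [NormedAddCommGroup D] [NormedSpace ℂ D]
    {S T : F.Envelope →L[ℂ] D} (h : ∀ a, S (of F a) = T (of F a)) : S = T :=
  ContinuousLinearMap.ext fun x => induction (isClosed_eq S.continuous T.continuous) h x

/-- Extension by continuity of a bounded linear map. -/
def extend {D : Type*} [NormedAddCommGroup D] [NormedSpace ℂ D] [CompleteSpace D]
    (φ : F.Pre →ₗ[ℂ] D) (C : ℝ) (h : ∀ x, ‖φ x‖ ≤ C * ‖x‖) : F.Envelope →L[ℂ] D :=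
  (φ.mkContinuous C h).fromCompletion

@[simp] theorem extend_of {D : Type*} [NormedAddCommGroup D] [NormedSpace ℂ D] [CompleteSpace D]
    (φ : F.Pre →ₗ[ℂ] D) (C : ℝ) (h : ∀ x, ‖φ x‖ ≤ C * ‖x‖) (x : F.Pre) :
    extend φ C h (of F x) = φ x :=
  ContinuousLinearMap.fromCompletion_apply_coe _ _

theorem norm_extend_le {D : Type*} [NormedAddCommGroup D] [NormedSpace ℂ D] [CompleteSpace D]
    (φ : F.Pre →ₗ[ℂ] D) (C : ℝ) (h : ∀ x, ‖φ x‖ ≤ C * ‖x‖) (x : F.Envelope) :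
    ‖extend φ C h x‖ ≤ C * ‖x‖ :=
  induction (p := fun x => ‖extend φ C h x‖ ≤ C * ‖x‖)
    (isClosed_le (by fun_prop) (by fun_prop)) (fun a => by simpa using h a) x

/-- Multiplication, extended to the completion by continuity. -/
def mulL : F.Envelope →L[ℂ] F.Envelope →L[ℂ] F.Envelope :=
  extend
    { toFun := fun a => extend ((of F).toLinearMap ∘ₗ LinearMap.mulLeft ℂ a) ‖a‖ fun x => by
        simpa using F.pre_norm_mul_le a x
      map_add' := fun a b => clm_ext fun x => by simp [add_mul]
      map_smul' := fun c a => clm_ext fun x => by simp [smul_mul_assoc] } 1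
    fun a => ContinuousLinearMap.opNorm_le_bound _ (by positivity) fun x => by
      simpa using norm_extend_le _ _ _ x

theorem mulL_of (a b : F.Pre) : mulL (of F a) (of F b) = of F (a * b) := by simp [mulL]

/-- The adjoint, extended to the completion by continuity. -/
def starL : F.Envelope →L⋆[ℂ] F.Envelope :=
  ContinuousLinearMap.completion (α := F.Pre) (β := F.Pre)
    ((starLinearEquiv ℂ (A := F.Pre)).toLinearMap.mkContinuous 1 fun x => by
      simp [pre_norm_star])

theorem starL_of (a : F.Pre) : starL (of F a) = of F (star a) :=
  ContinuousLinearMap.completion_apply_coe _ _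

instance : Mul F.Envelope := ⟨fun x y => mulL x y⟩
instance : Star F.Envelope := ⟨fun x => starL x⟩

theorem mul_def (x y : F.Envelope) : x * y = mulL x y := rfl
theorem star_def (x : F.Envelope) : star x = starL x := rfl

theorem of_mul (a b : F.Pre) : of F (a * b) = of F a * of F b := (mulL_of a b).symm
theorem of_star (a : F.Pre) : of F (star a) = star (of F a) := (starL_of a).symm

theorem continuous_mulE : Continuous fun p : F.Envelope × F.Envelope => p.1 * p.2 :=
  (mulL (F := F)).continuous.comp continuous_fst |>.clm_apply continuous_snd

theorem continuous_starE : Continuous fun p : F.Envelope => star p := (starL (F := F)).continuous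

theorem induction₂ {p : F.Envelope → F.Envelope → Prop}
    (hc : IsClosed {x : F.Envelope × F.Envelope | p x.1 x.2}) (h : ∀ a b, p (of F a) (of F b))
    (x y : F.Envelope) : p x y := Completion.induction_on₂ x y hc h

theorem induction₃ {p : F.Envelope → F.Envelope → F.Envelope → Prop}
    (hc : IsClosed {x : F.Envelope × F.Envelope × F.Envelope | p x.1 x.2.1 x.2.2})
    (h : ∀ a b c, p (of F a) (of F b) (of F c))
    (x y z : F.Envelope) : p x y z := Completion.induction_on₃ x y z hc h

instance : NonUnitalNormedRing F.Envelope where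
  __ := (inferInstance : NormedAddCommGroup F.Envelope)
  mul := (· * ·)
  left_distrib x y z := by simp [mul_def]
  right_distrib x y z := by simp [mul_def]
  zero_mul x := by simp [mul_def]
  mul_zero x := by simp [mul_def]
  mul_assoc := induction₃ (isClosed_eq
    (continuous_mulE.comp ((continuous_mulE.comp
      (continuous_fst.prodMk (continuous_fst.comp continuous_snd))).prodMk
        (continuous_snd.comp continuous_snd)))
    (continuous_mulE.comp (continuous_fst.prodMk (continuous_mulE.comp continuous_snd))))
    fun a b c => by simp only [← of_mul, mul_assoc]
  norm_mul_le := induction₂ (isClosed_le continuous_mulE.norm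
    ((continuous_norm.comp continuous_fst).mul (continuous_norm.comp continuous_snd)))
    fun a b => by simpa [← of_mul] using F.pre_norm_mul_le a b

instance : StarRing F.Envelope where
  star_involutive := induction (isClosed_eq (continuous_starE.comp continuous_starE)
    continuous_id) fun a => by simp [← of_star]
  star_mul := induction₂ (isClosed_eq (continuous_starE.comp continuous_mulE)
    (continuous_mulE.comp ((continuous_starE.comp continuous_snd).prodMk
      (continuous_starE.comp continuous_fst)))) fun a b => by simp [← of_star, ← of_mul]
  star_add x y := by simp [star_def]

instance : NonUnitalCStarAlgebra F.Envelope where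
  smul_assoc c x y := by simp [mul_def]
  smul_comm c x y := by simp [mul_def]
  star_smul c x := by simp [star_def]
  norm_mul_self_le := induction (isClosed_le (continuous_norm.mul continuous_norm)
    (continuous_mulE.comp (continuous_starE.prodMk continuous_id)).norm)
    fun a => by simpa [← of_star, ← of_mul] using F.pre_norm_mul_self_le a

/-- A contractive `*`-homomorphism on `R` extends to the completion. -/
def lift {D : Type*} [NonUnitalCStarAlgebra D] (φ : F.Pre →⋆ₙₐ[ℂ] D)
    (h : ∀ x, ‖φ x‖ ≤ ‖x‖) : F.Envelope →⋆ₙₐ[ℂ] D :=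
  let ψ := extend (φ : F.Pre →ₗ[ℂ] D) 1 (by simpa using h)
  { toFun := ψ
    map_smul' := map_smul ψ
    map_zero' := map_zero ψ
    map_add' := map_add ψ
    map_mul' := induction₂ (isClosed_eq (ψ.continuous.comp continuous_mul)
      ((ψ.continuous.comp continuous_fst).mul (ψ.continuous.comp continuous_snd)))
      fun a b => by simp [ψ, ← of_mul]
    map_star' := induction (isClosed_eq (ψ.continuous.comp continuous_star)
      (continuous_star.comp ψ.continuous)) fun a => by simp [ψ, ← of_star, map_star] }

@[simp] theorem lift_of {D : Type*} [NonUnitalCStarAlgebra D] (φ : F.Pre →⋆ₙₐ[ℂ] D)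
    (h : ∀ x, ‖φ x‖ ≤ ‖x‖) (x : F.Pre) : lift φ h (of F x) = φ x :=
  extend_of (φ : F.Pre →ₗ[ℂ] D) 1 _ x

/-- The representations of the family, extended to the completion. -/
def rep (F : RepFamily R) (i : F.Index) : F.Envelope →⋆ₙₐ[ℂ] (F.Space i →L[ℂ] F.Space i) :=
  lift (F.preRep i) (F.norm_preRep_le i)

@[simp] theorem rep_of (i : F.Index) (x : F.Pre) : rep F i (of F x) = F.preRep i x :=
  lift_of _ _ x

theorem norm_le_of_rep (t : F.Envelope) {M : ℝ} (hM : 0 ≤ M) (h : ∀ i, ‖rep F i t‖ ≤ M) :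
    ‖t‖ ≤ M := by
  refine le_of_forall_pos_le_add fun ε hε => ?_
  obtain ⟨a, ha⟩ := (denseRange_of (F := F)).exists_dist_lt t (half_pos hε)
  rw [dist_eq_norm] at ha
  have h1 : ‖a‖ ≤ M + ε / 2 := F.norm_le (by positivity) fun i => by
    have h2 : F.preRep i a = rep F i t - rep F i (t - of F a) := by simp
    rw [h2]
    exact (norm_sub_le _ _).trans (add_le_add (h i)
      ((NonUnitalStarAlgHom.norm_apply_le (rep F i) _).trans ha.le))
  calc ‖t‖ = ‖of F a + (t - of F a)‖ := by simp
    _ ≤ ‖of F a‖ + ‖t - of F a‖ := norm_add_le _ _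
    _ ≤ (M + ε / 2) + ε / 2 := add_le_add (by simpa using h1) ha.le
    _ = M + ε := by ring

theorem ext_of_rep {s t : F.Envelope} (h : ∀ i, rep F i s = rep F i t) : s = t := by
  rw [← sub_eq_zero, ← norm_le_zero_iff]
  exact norm_le_of_rep _ le_rfl fun i => by simp [h]

/-- The canonical `*`-homomorphism of `R` into its completion. -/
def inc (F : RepFamily R) : R →⋆ₙₐ[ℂ] F.Envelope where
  toFun x := of F (F.toPre x)
  map_smul' c x := map_smul ((of F).toLinearMap ∘ₗ F.toPre) c x
  map_zero' := map_zero ((of F).toLinearMap ∘ₗ F.toPre)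
  map_add' := map_add ((of F).toLinearMap ∘ₗ F.toPre)
  map_mul' x y := of_mul (F.toPre x) (F.toPre y)
  map_star' x := of_star (F.toPre x)

theorem denseRange_inc : DenseRange (inc F) := denseRange_of

/-- A `*`-homomorphism on `R` which is contractive for the seminorm extends to the completion. -/
def liftInc {D : Type*} [NonUnitalCStarAlgebra D] (φ : R →⋆ₙₐ[ℂ] D)
    (h : ∀ x, ‖φ x‖ ≤ ‖inc F x‖) : F.Envelope →⋆ₙₐ[ℂ] D :=
  lift (F := F) φ fun x => (h x).trans ((of F).norm_map x).le

@[simp] theorem liftInc_inc {D : Type*} [NonUnitalCStarAlgebra D] (φ : R →⋆ₙₐ[ℂ] D)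
    (h : ∀ x, ‖φ x‖ ≤ ‖inc F x‖) (x : R) : liftInc φ h (inc F x) = φ x :=
  lift_of (F := F) φ _ _

theorem norm_rep_le_inc (i : F.Index) (x : R) : ‖F.rep i x‖ ≤ ‖inc F x‖ :=
  (F.norm_preRep_le i x).trans ((of F).norm_map (F.toPre x)).ge

theorem norm_inc_le (x : R) {M : ℝ} (hM : 0 ≤ M) (h : ∀ i, ‖F.rep i x‖ ≤ M) : ‖inc F x‖ ≤ M :=
  ((of F).norm_map (F.toPre x)).le.trans (F.norm_le hM h)

@[simp] theorem rep_inc (i : F.Index) (x : R) : rep F i (inc F x) = F.rep i x := rep_of i x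

end Envelope
end RepFamily

section HilbertTensorSec

variable {H K L : Type u}
  [NormedAddCommGroup H] [InnerProductSpace ℂ H]
  [NormedAddCommGroup K] [InnerProductSpace ℂ K]
  [NormedAddCommGroup L] [InnerProductSpace ℂ L]

/-- The Hilbert space tensor product `H ⊗̂ K`: the completion of the algebraic tensor product. -/
def HilbertTensor (H K : Type u) [NormedAddCommGroup H] [InnerProductSpace ℂ H]
    [NormedAddCommGroup K] [InnerProductSpace ℂ K] : Type u := Completion (H ⊗[ℂ] K)

namespace HilbertTensor

instance : NormedAddCommGroup (HilbertTensor H K) :=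
  inferInstanceAs (NormedAddCommGroup (Completion (H ⊗[ℂ] K)))
instance : InnerProductSpace ℂ (HilbertTensor H K) :=
  inferInstanceAs (InnerProductSpace ℂ (Completion (H ⊗[ℂ] K)))
instance : CompleteSpace (HilbertTensor H K) :=
  inferInstanceAs (CompleteSpace (Completion (H ⊗[ℂ] K)))

/-- The canonical isometry of the algebraic tensor product into its completion. -/
def of : H ⊗[ℂ] K →ₗᵢ[ℂ] HilbertTensor H K := Completion.toComplₗᵢ

theorem induction {p : HilbertTensor H K → Prop} (hc : IsClosed {x | p x})
    (h : ∀ a : H ⊗[ℂ] K, p (of a)) (x : HilbertTensor H K) : p x := Completion.induction_on x hc h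

theorem clm_ext {D : Type*} [NormedAddCommGroup D] [NormedSpace ℂ D]
    {S T : HilbertTensor H K →L[ℂ] D} (h : ∀ x, S (of x) = T (of x)) : S = T :=
  ContinuousLinearMap.ext fun x => induction (isClosed_eq S.continuous T.continuous) h x

/-- Extension of an operator to the completion. -/
def opExt (S : H ⊗[ℂ] K →L[ℂ] H ⊗[ℂ] K) : HilbertTensor H K →L[ℂ] HilbertTensor H K :=
  ContinuousLinearMap.completion S

@[simp] theorem opExt_of (S : H ⊗[ℂ] K →L[ℂ] H ⊗[ℂ] K) (x : H ⊗[ℂ] K) :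
    opExt S (of x) = of (S x) := ContinuousLinearMap.completion_apply_coe _ _

theorem norm_opExt_le (S : H ⊗[ℂ] K →L[ℂ] H ⊗[ℂ] K) : ‖opExt S‖ ≤ ‖S‖ :=
  ContinuousLinearMap.opNorm_le_bound _ S.opNorm_nonneg
    (induction (isClosed_le (by fun_prop) (by fun_prop)) fun a => by simpa using S.le_opNorm a)

/-- Formally adjoint operators on the algebraic tensor product have adjoint extensions. -/
theorem opExt_adjoint (S T : H ⊗[ℂ] K →L[ℂ] H ⊗[ℂ] K)
    (h : ∀ x y, ⟪S x, y⟫_ℂ = ⟪x, T y⟫_ℂ) : opExt S = star (opExt T) := by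
  refine (ContinuousLinearMap.eq_adjoint_iff _ _).2 fun x => ?_
  refine induction (isClosed_eq (by fun_prop) (by fun_prop)) fun y => ?_
  revert x
  refine induction (isClosed_eq (by fun_prop) (by fun_prop)) fun x => ?_
  simpa using h x y

end HilbertTensor

open HilbertTensor

/-- The operator `S ⊗ T` on the Hilbert space tensor product `H ⊗̂ K`. -/
def opTensor (S : H →L[ℂ] H) (T : K →L[ℂ] K) : HilbertTensor H K →L[ℂ] HilbertTensor H K :=
  opExt (TensorProduct.mapL S T)

@[simp] theorem opTensor_of (S : H →L[ℂ] H) (T : K →L[ℂ] K) (x : H ⊗[ℂ] K) :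
    opTensor S T (of x) = of (TensorProduct.mapL S T x) := opExt_of _ _

theorem norm_opTensor_le (S : H →L[ℂ] H) (T : K →L[ℂ] K) : ‖opTensor S T‖ ≤ ‖S‖ * ‖T‖ :=
  (norm_opExt_le _).trans (TensorProduct.norm_mapL_le S T)

/-- `(S, T) ↦ S ⊗ T` as a bilinear map. -/
def opTensorₗ : (H →L[ℂ] H) →ₗ[ℂ] (K →L[ℂ] K) →ₗ[ℂ]
    (HilbertTensor H K →L[ℂ] HilbertTensor H K) :=
  LinearMap.mk₂ ℂ opTensor
    (fun _ _ _ => clm_ext fun x => by simp [TensorProduct.map_add_left])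
    (fun _ _ _ => clm_ext fun x => by simp [TensorProduct.map_smul_left])
    (fun _ _ _ => clm_ext fun x => by simp [TensorProduct.map_add_right])
    (fun _ _ _ => clm_ext fun x => by simp [TensorProduct.map_smul_right])

@[simp] theorem opTensorₗ_apply (S : H →L[ℂ] H) (T : K →L[ℂ] K) :
    opTensorₗ S T = opTensor S T := rfl

theorem opTensor_mul (S S' : H →L[ℂ] H) (T T' : K →L[ℂ] K) :
    opTensor (S * S') (T * T') = opTensor S T * opTensor S' T' :=
  clm_ext fun x => by
    rw [mul_apply_eq_comp, opTensor_of, opTensor_of, opTensor_of,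
      TensorProduct.mapL_mul, mul_apply_eq_comp]

theorem mapL_adjoint_inner {S S' : H →L[ℂ] H} {T T' : K →L[ℂ] K}
    (hS : ∀ x y, ⟪S x, y⟫_ℂ = ⟪x, S' y⟫_ℂ) (hT : ∀ x y, ⟪T x, y⟫_ℂ = ⟪x, T' y⟫_ℂ)
    (x y : H ⊗[ℂ] K) :
    ⟪TensorProduct.mapL S T x, y⟫_ℂ = ⟪x, TensorProduct.mapL S' T' y⟫_ℂ := by
  induction x with
  | zero => simp
  | add x₁ x₂ h₁ h₂ => simp only [map_add, inner_add_left, h₁, h₂]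
  | tmul a b =>
    induction y with
    | zero => simp
    | add y₁ y₂ h₁ h₂ => simp only [map_add, inner_add_right, h₁, h₂]
    | tmul c d => simp [hS, hT]

theorem opTensor_star [CompleteSpace H] [CompleteSpace K] (S : H →L[ℂ] H) (T : K →L[ℂ] K) :
    opTensor (star S) (star T) = star (opTensor S T) :=
  opExt_adjoint _ _ (mapL_adjoint_inner
    (fun x y => ContinuousLinearMap.adjoint_inner_left S y x)
    (fun x y => ContinuousLinearMap.adjoint_inner_left T y x))

/-- `(S, T) ↦ S ⊗ T` on the algebraic tensor product, as a bilinear map. -/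
def mapLₗ : (K →L[ℂ] K) →ₗ[ℂ] (L →L[ℂ] L) →ₗ[ℂ] (K ⊗[ℂ] L →L[ℂ] K ⊗[ℂ] L) :=
  LinearMap.mk₂ ℂ TensorProduct.mapL TensorProduct.mapL_add_left TensorProduct.mapL_smul_left
    TensorProduct.mapL_add_right TensorProduct.mapL_smul_right

@[simp] theorem mapLₗ_apply (S : H →L[ℂ] H) (T : K →L[ℂ] K) :
    mapLₗ S T = TensorProduct.mapL S T := rfl

theorem opTensor₃_star [CompleteSpace H] [CompleteSpace K] [CompleteSpace L]
    (S : H →L[ℂ] H) (T : K →L[ℂ] K) (U : L →L[ℂ] L) :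
    opTensor (star S) (TensorProduct.mapL (star T) (star U)) =
      star (opTensor S (TensorProduct.mapL T U)) :=
  opExt_adjoint _ _ (mapL_adjoint_inner
    (fun x y => ContinuousLinearMap.adjoint_inner_left S y x)
    (mapL_adjoint_inner
      (fun x y => ContinuousLinearMap.adjoint_inner_left T y x)
      (fun x y => ContinuousLinearMap.adjoint_inner_left U y x)))

end HilbertTensorSec

section Reps

open HilbertTensor

variable {A B C : Type u} [NonUnitalRing A] [StarRing A] [Module ℂ A] [StarModule ℂ A]
  [IsScalarTower ℂ A A] [SMulCommClass ℂ A A]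
  [NonUnitalRing B] [StarRing B] [Module ℂ B] [StarModule ℂ B]
  [IsScalarTower ℂ B B] [SMulCommClass ℂ B B]
  [NonUnitalRing C] [StarRing C] [Module ℂ C] [StarModule ℂ C]
  [IsScalarTower ℂ C C] [SMulCommClass ℂ C C]
variable {H K L : Type u}
  [NormedAddCommGroup H] [InnerProductSpace ℂ H] [CompleteSpace H]
  [NormedAddCommGroup K] [InnerProductSpace ℂ K] [CompleteSpace K]
  [NormedAddCommGroup L] [InnerProductSpace ℂ L] [CompleteSpace L]

/-- The tensor product `π ⊗ σ` of two representations, on the Hilbert space `H ⊗̂ K`. -/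
def tensorRep (π : A →⋆ₙₐ[ℂ] (H →L[ℂ] H)) (σ : B →⋆ₙₐ[ℂ] (K →L[ℂ] K)) :
    (A ⊗[ℂ] B) →⋆ₙₐ[ℂ] (HilbertTensor H K →L[ℂ] HilbertTensor H K) :=
  liftStarHom (opTensorₗ.compl₁₂ (π : A →ₗ[ℂ] _) (σ : B →ₗ[ℂ] _))
    (fun a a' b b' => by simp [opTensor_mul])
    (fun a b => by simp [map_star, opTensor_star])

@[simp] theorem tensorRep_tmul (π : A →⋆ₙₐ[ℂ] (H →L[ℂ] H)) (σ : B →⋆ₙₐ[ℂ] (K →L[ℂ] K))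
    (a : A) (b : B) : tensorRep π σ (a ⊗ₜ b) = opTensor (π a) (σ b) := rfl

/-- The algebraic action of `B ⊗ C` on `K ⊗ L`. -/
def tensorRepAlg (σ : B →⋆ₙₐ[ℂ] (K →L[ℂ] K)) (τ : C →⋆ₙₐ[ℂ] (L →L[ℂ] L)) :
    (B ⊗[ℂ] C) →ₗ[ℂ] (K ⊗[ℂ] L →L[ℂ] K ⊗[ℂ] L) :=
  TensorProduct.lift (mapLₗ.compl₁₂ (σ : B →ₗ[ℂ] _) (τ : C →ₗ[ℂ] _))

@[simp] theorem tensorRepAlg_tmul (σ : B →⋆ₙₐ[ℂ] (K →L[ℂ] K)) (τ : C →⋆ₙₐ[ℂ] (L →L[ℂ] L))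
    (b : B) (c : C) : tensorRepAlg σ τ (b ⊗ₜ c) = TensorProduct.mapL (σ b) (τ c) := rfl

theorem tensorRepAlg_mul (σ : B →⋆ₙₐ[ℂ] (K →L[ℂ] K)) (τ : C →⋆ₙₐ[ℂ] (L →L[ℂ] L))
    (x y : B ⊗[ℂ] C) : tensorRepAlg σ τ (x * y) = tensorRepAlg σ τ x * tensorRepAlg σ τ y := by
  induction x with
  | zero => simp
  | add x₁ x₂ h₁ h₂ => simp only [add_mul, map_add, h₁, h₂]
  | tmul a b =>
    induction y with
    | zero => simp
    | add y₁ y₂ h₁ h₂ => simp only [mul_add, map_add, h₁, h₂]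
    | tmul c d => simp [TensorProduct.mapL_mul]

/-- The tensor product `π ⊗ σ ⊗ τ` of three representations, on the Hilbert space
`H ⊗̂ K ⊗̂ L`. -/
def tensorRep₃ (π : A →⋆ₙₐ[ℂ] (H →L[ℂ] H)) (σ : B →⋆ₙₐ[ℂ] (K →L[ℂ] K))
    (τ : C →⋆ₙₐ[ℂ] (L →L[ℂ] L)) :
    (A ⊗[ℂ] (B ⊗[ℂ] C)) →⋆ₙₐ[ℂ] (HilbertTensor H (K ⊗[ℂ] L) →L[ℂ]
      HilbertTensor H (K ⊗[ℂ] L)) :=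
  liftStarHom (opTensorₗ.compl₁₂ (π : A →ₗ[ℂ] _) (tensorRepAlg σ τ))
    (fun a a' b b' => by simp [tensorRepAlg_mul, opTensor_mul])
    (fun a x => by
      simp only [LinearMap.compl₁₂_apply, opTensorₗ_apply]
      induction x with
      | zero => simp [← opTensorₗ_apply]
      | add x₁ x₂ h₁ h₂ =>
        simp only [← opTensorₗ_apply] at h₁ h₂ ⊢
        simp only [star_add, map_add, h₁, h₂]
      | tmul b c =>
        have := opTensor₃_star (π a) (σ b) (τ c)
        simpa [map_star] using this)

@[simp] theorem tensorRep₃_tmul (π : A →⋆ₙₐ[ℂ] (H →L[ℂ] H)) (σ : B →⋆ₙₐ[ℂ] (K →L[ℂ] K))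
    (τ : C →⋆ₙₐ[ℂ] (L →L[ℂ] L)) (a : A) (b : B) (c : C) :
    tensorRep₃ π σ τ (a ⊗ₜ (b ⊗ₜ c)) = opTensor (π a) (TensorProduct.mapL (σ b) (τ c)) := rfl

theorem tensorRep₃_tmul' (π : A →⋆ₙₐ[ℂ] (H →L[ℂ] H)) (σ : B →⋆ₙₐ[ℂ] (K →L[ℂ] K))
    (τ : C →⋆ₙₐ[ℂ] (L →L[ℂ] L)) (a : A) (x : B ⊗[ℂ] C) :
    tensorRep₃ π σ τ (a ⊗ₜ x) = opTensor (π a) (tensorRepAlg σ τ x) := rfl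

end Reps

section Min
variable (A B C : Type u) [NonUnitalCStarAlgebra A] [NonUnitalCStarAlgebra B]
  [NonUnitalCStarAlgebra C]

/-- A representation of the C⋆-algebra `A` on some Hilbert space. -/
structure HilbertRep where
  Space : Type u
  [normed : NormedAddCommGroup Space]
  [inner : InnerProductSpace ℂ Space]
  [complete : CompleteSpace Space]
  rep : A →⋆ₙₐ[ℂ] (Space →L[ℂ] Space)

attribute [instance] HilbertRep.normed HilbertRep.inner HilbertRep.complete

/-- The representations `π ⊗ σ` of the algebraic tensor product `A ⊗ B`, for all representations
`π` of `A` and `σ` of `B`. -/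
def minFamily : RepFamily (A ⊗[ℂ] B) where
  Index := HilbertRep A × HilbertRep B
  Space i := HilbertTensor i.1.Space i.2.Space
  rep i := tensorRep i.1.rep i.2.rep
  bounded x := by
    induction x with
    | zero => exact ⟨0, by rintro _ ⟨i, rfl⟩; simp⟩
    | add x y hx hy =>
      obtain ⟨M, hM⟩ := hx
      obtain ⟨N, hN⟩ := hy
      refine ⟨M + N, ?_⟩
      rintro _ ⟨i, rfl⟩
      simp only [map_add]
      exact (norm_add_le _ _).trans (add_le_add (hM ⟨i, rfl⟩) (hN ⟨i, rfl⟩))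
    | tmul a b =>
      refine ⟨‖a‖ * ‖b‖, ?_⟩
      rintro _ ⟨i, rfl⟩
      exact (norm_opTensor_le _ _).trans (mul_le_mul
        (NonUnitalStarAlgHom.norm_apply_le i.1.rep a)
        (NonUnitalStarAlgHom.norm_apply_le i.2.rep b) (norm_nonneg _) (norm_nonneg _))

/-- The minimal (spatial) C⋆-tensor product `A ⊗ B`: the completion of the algebraic tensor
product in the norm `‖x‖ = sup ‖(π ⊗ σ)(x)‖`, the supremum being over all representations `π` of
`A` and `σ` of `B` on Hilbert spaces. -/
abbrev MinTensor : Type u := (minFamily A B).Envelope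

/-- The representations `π ⊗ σ ⊗ τ` of the algebraic tensor product `A ⊗ B ⊗ C`. -/
def minFamily₃ : RepFamily (A ⊗[ℂ] (B ⊗[ℂ] C)) where
  Index := HilbertRep A × HilbertRep B × HilbertRep C
  Space i := HilbertTensor i.1.Space (i.2.1.Space ⊗[ℂ] i.2.2.Space)
  rep i := tensorRep₃ i.1.rep i.2.1.rep i.2.2.rep
  bounded x := by
    induction x with
    | zero => exact ⟨0, by rintro _ ⟨i, rfl⟩; simp⟩
    | add x y hx hy =>
      obtain ⟨M, hM⟩ := hx
      obtain ⟨N, hN⟩ := hy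
      refine ⟨M + N, ?_⟩
      rintro _ ⟨i, rfl⟩
      simp only [map_add]
      exact (norm_add_le _ _).trans (add_le_add (hM ⟨i, rfl⟩) (hN ⟨i, rfl⟩))
    | tmul a x =>
      induction x with
      | zero => exact ⟨0, by rintro _ ⟨i, rfl⟩; simp⟩
      | add x y hx hy =>
        obtain ⟨M, hM⟩ := hx
        obtain ⟨N, hN⟩ := hy
        refine ⟨M + N, ?_⟩
        rintro _ ⟨i, rfl⟩
        simp only [TensorProduct.tmul_add, map_add]
        exact (norm_add_le _ _).trans (add_le_add (hM ⟨i, rfl⟩) (hN ⟨i, rfl⟩))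
      | tmul b c =>
        refine ⟨‖a‖ * (‖b‖ * ‖c‖), ?_⟩
        rintro _ ⟨i, rfl⟩
        have hb := NonUnitalStarAlgHom.norm_apply_le i.2.1.rep b
        have hc := NonUnitalStarAlgHom.norm_apply_le i.2.2.rep c
        have ha := NonUnitalStarAlgHom.norm_apply_le i.1.rep a
        exact (norm_opTensor_le _ _).trans (mul_le_mul ha
          ((TensorProduct.norm_mapL_le _ _).trans (mul_le_mul hb hc (norm_nonneg _)
            (norm_nonneg _))) (norm_nonneg _) (norm_nonneg _))

/-- The minimal (spatial) C⋆-tensor product `A ⊗ B ⊗ C` of three C⋆-algebras. -/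
abbrev MinTensor₃ : Type u := (minFamily₃ A B C).Envelope

variable {A B C}

/-- Inclusion of the algebraic tensor product. -/
def MinTensor.inc : (A ⊗[ℂ] B) →⋆ₙₐ[ℂ] MinTensor A B := RepFamily.Envelope.inc _

/-- The representation `π ⊗ σ` of `A ⊗ B`. -/
def MinTensor.rep (π : HilbertRep A) (σ : HilbertRep B) :
    MinTensor A B →⋆ₙₐ[ℂ] (HilbertTensor π.Space σ.Space →L[ℂ] HilbertTensor π.Space σ.Space) :=
  RepFamily.Envelope.liftInc (F := minFamily A B) (tensorRep π.rep σ.rep) fun x =>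
    RepFamily.Envelope.norm_rep_le_inc (F := minFamily A B) (π, σ) x

theorem MinTensor.rep_inc (π : HilbertRep A) (σ : HilbertRep B) (x : A ⊗[ℂ] B) :
    MinTensor.rep π σ (MinTensor.inc x) = tensorRep π.rep σ.rep x :=
  RepFamily.Envelope.liftInc_inc (F := minFamily A B) _ _ x

/-- Inclusion of the algebraic tensor product. -/
def MinTensor₃.inc : (A ⊗[ℂ] (B ⊗[ℂ] C)) →⋆ₙₐ[ℂ] MinTensor₃ A B C := RepFamily.Envelope.inc _

/-- The representation `π ⊗ σ ⊗ τ` of `A ⊗ B ⊗ C`. -/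
def MinTensor₃.rep (π : HilbertRep A) (σ : HilbertRep B) (τ : HilbertRep C) :
    MinTensor₃ A B C →⋆ₙₐ[ℂ] (HilbertTensor π.Space (σ.Space ⊗[ℂ] τ.Space) →L[ℂ]
      HilbertTensor π.Space (σ.Space ⊗[ℂ] τ.Space)) :=
  RepFamily.Envelope.liftInc (F := minFamily₃ A B C) (tensorRep₃ π.rep σ.rep τ.rep) fun x =>
    RepFamily.Envelope.norm_rep_le_inc (F := minFamily₃ A B C) (π, σ, τ) x

theorem MinTensor₃.rep_inc (π : HilbertRep A) (σ : HilbertRep B) (τ : HilbertRep C)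
    (x : A ⊗[ℂ] (B ⊗[ℂ] C)) :
    MinTensor₃.rep π σ τ (MinTensor₃.inc x) = tensorRep₃ π.rep σ.rep τ.rep x :=
  RepFamily.Envelope.liftInc_inc (F := minFamily₃ A B C) _ _ x

theorem MinTensor₃.norm_inc_le (x : A ⊗[ℂ] (B ⊗[ℂ] C)) {M : ℝ} (hM : 0 ≤ M)
    (h : ∀ π σ τ, ‖MinTensor₃.rep π σ τ (MinTensor₃.inc x)‖ ≤ M) : ‖MinTensor₃.inc x‖ ≤ M :=
  RepFamily.Envelope.norm_inc_le (F := minFamily₃ A B C) x hM fun i => by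
    have := h i.1 i.2.1 i.2.2
    rw [MinTensor₃.rep_inc] at this
    exact this

theorem MinTensor₃.norm_le (t : MinTensor₃ A B C) {M : ℝ} (hM : 0 ≤ M)
    (h : ∀ π σ τ, ‖MinTensor₃.rep π σ τ t‖ ≤ M) : ‖t‖ ≤ M :=
  RepFamily.Envelope.norm_le_of_rep t hM fun i => h i.1 i.2.1 i.2.2

end Min

section Multiplier

variable {X : Type u} [NonUnitalCStarAlgebra X]

theorem eq_of_forall_mul {x y : X} (h : ∀ z, z * x = z * y) : x = y := by
  rw [← sub_eq_zero, ← norm_eq_zero, ← mul_self_eq_zero, ← CStarRing.norm_star_mul_self,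
    mul_sub, h, sub_self, norm_zero]

theorem fst_mul (m : 𝓜(ℂ, X)) (x y : X) : m.fst (x * y) = m.fst x * y :=
  eq_of_forall_mul fun z => by rw [← m.central, ← mul_assoc, m.central, mul_assoc]

/-- A multiplier is determined by its left action. -/
theorem multiplier_ext {m n : 𝓜(ℂ, X)} (h : ∀ x, m.fst x = n.fst x) : m = n := by
  rw [← sub_eq_zero, ← norm_eq_zero, ← DoubleCentralizer.norm_fst, norm_eq_zero]
  exact ContinuousLinearMap.ext fun x => by simp [h]

end Multiplier

section ExtendRep

variable {X : Type u} [NonUnitalCStarAlgebra X]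
  {H : Type u} [NormedAddCommGroup H] [InnerProductSpace ℂ H] [CompleteSpace H]
  (π : X →⋆ₙₐ[ℂ] (H →L[ℂ] H))

/-- The linear map `∑ x ⊗ h ↦ ∑ π(m x) h`. -/
def actMul (m : X →L[ℂ] X) : X ⊗[ℂ] H →ₗ[ℂ] H :=
  TensorProduct.lift ((ContinuousLinearMap.coeLM ℂ).comp ((π : X →ₗ[ℂ] _).comp (m : X →ₗ[ℂ] X)))

@[simp] theorem actMul_tmul (m : X →L[ℂ] X) (x : X) (h : H) :
    actMul π m (x ⊗ₜ h) = π (m x) h := rfl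

theorem continuous_starHom {D : Type*} [NonUnitalCStarAlgebra D] (π : X →⋆ₙₐ[ℂ] D) :
    Continuous π :=
  AddMonoidHomClass.continuous_of_bound π 1 fun x => by
    simpa using NonUnitalStarAlgHom.norm_apply_le π x

theorem norm_actMul_le (m : 𝓜(ℂ, X)) (w : X ⊗[ℂ] H) :
    ‖actMul π m.fst w‖ ≤ ‖m.fst‖ * ‖actMul π (.id ℂ X) w‖ := by
  let _ := CStarAlgebra.spectralOrder X
  have _ := CStarAlgebra.spectralOrderedRing X
  have hl := CStarAlgebra.increasingApproximateUnit X
  have ht : Filter.Tendsto (fun e => π (m.fst e) (actMul π (.id ℂ X) w))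
      (CStarAlgebra.approximateUnit X) (nhds (actMul π m.fst w)) := by
    induction w with
    | zero => simp
    | add x y hx hy => simpa using hx.add hy
    | tmul x h =>
      have h1 : Filter.Tendsto (fun e : X => π (m.fst (e * x)) h)
          (CStarAlgebra.approximateUnit X) (nhds (π (m.fst x) h)) := by
        have hc : Continuous fun y : X => π (m.fst y) h :=
          ((continuous_starHom π).comp m.fst.continuous).clm_apply continuous_const
        exact (hc.tendsto x).comp (hl.tendsto_mul_right x)
      refine h1.congr fun e => ?_
      simp [fst_mul]
  have _ := hl.neBot
  refine le_of_tendsto ht.norm ?_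
  filter_upwards [hl.eventually_norm] with e he
  refine (ContinuousLinearMap.le_opNorm _ _).trans ?_
  gcongr
  refine (NonUnitalStarAlgHom.norm_apply_le π _).trans ((m.fst.le_opNorm e).trans ?_)
  exact mul_le_of_le_one_right (norm_nonneg _) he

/-- The essential subspace of a representation. -/
def essSpace : Submodule ℂ H := (LinearMap.range (actMul π (.id ℂ X))).topologicalClosure

instance : CompleteSpace (essSpace π) :=
  (Submodule.isClosed_topologicalClosure _).completeSpace_coe

theorem rep_mem_essSpace (x : X) (h : H) : π x h ∈ essSpace π :=
  Submodule.le_topologicalClosure _ ⟨x ⊗ₜ h, rfl⟩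

theorem actMul_mem_essSpace (m : X →L[ℂ] X) (w : X ⊗[ℂ] H) : actMul π m w ∈ essSpace π := by
  induction w with
  | zero => simp
  | add x y hx hy => simpa using add_mem hx hy
  | tmul x h => exact rep_mem_essSpace π _ _

def toEss : X ⊗[ℂ] H →ₗ[ℂ] essSpace π :=
  (actMul π (.id ℂ X)).codRestrict _ (actMul_mem_essSpace π _)

theorem denseRange_toEss : DenseRange (toEss π) := by
  rw [DenseRange, Subtype.dense_iff]
  intro x hx
  have : ((↑) : essSpace π → H) '' Set.range (toEss π) =
      (LinearMap.range (actMul π (.id ℂ X)) : Set H) := by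
    ext y
    constructor
    · rintro ⟨_, ⟨w, rfl⟩, rfl⟩
      exact ⟨w, rfl⟩
    · rintro ⟨w, rfl⟩
      exact ⟨_, ⟨w, rfl⟩, rfl⟩
  exact (congrArg (fun s => x ∈ closure s) this).mpr hx

/-- The operator by which a multiplier acts: `π(x) h ↦ π(m x) h`, and zero on the orthogonal
complement of the essential subspace. -/
def extOp (m : 𝓜(ℂ, X)) : H →L[ℂ] H :=
  ((actMul π m.fst).extendOfNorm (toEss π)).comp (essSpace π).orthogonalProjectionOnto

theorem extOp_apply (m : 𝓜(ℂ, X)) (x : X) (h : H) : extOp π m (π x h) = π (m.fst x) h := by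
  have h1 : (essSpace π).orthogonalProjectionOnto (π x h) = toEss π (x ⊗ₜ h) :=
    Submodule.orthogonalProjectionOnto_mem_subspace_eq_self (toEss π (x ⊗ₜ h))
  rw [extOp, ContinuousLinearMap.comp_apply, h1, LinearMap.extendOfNorm_eq (denseRange_toEss π)
    ⟨‖m.fst‖, fun w => norm_actMul_le π m w⟩]
  rfl

theorem extOp_apply_perp (m : 𝓜(ℂ, X)) {k : H} (hk : k ∈ (essSpace π)ᗮ) : extOp π m k = 0 := by
  rw [extOp, ContinuousLinearMap.comp_apply,
    Submodule.orthogonalProjectionOnto_apply_of_mem_orthogonal hk, map_zero]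

theorem ess_induction {p : H → Prop} (hc : IsClosed {x | p x})
    (hadd : ∀ x y, p x → p y → p (x + y)) (h0 : p 0) (h : ∀ x k, p (π x k))
    {x : H} (hx : x ∈ essSpace π) : p x := by
  have hs : (LinearMap.range (actMul π (.id ℂ X)) : Set H) ⊆ {x | p x} := by
    rintro _ ⟨w, rfl⟩
    induction w with
    | zero => simpa using h0
    | add x y hx hy => simpa using hadd _ _ hx hy
    | tmul x k => exact h x k
  exact closure_minimal hs hc hx

theorem op_ext {S T : H →L[ℂ] H} (h : ∀ x k, S (π x k) = T (π x k))
    (h' : ∀ k ∈ (essSpace π)ᗮ, S k = T k) : S = T := by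
  ext k
  obtain ⟨y, hy, z, hz, rfl⟩ := (essSpace π).exists_add_mem_mem_orthogonal k
  rw [map_add, map_add, h' z hz]
  congr 1
  exact ess_induction π (isClosed_eq S.continuous T.continuous)
    (fun x y hx hy => by rw [map_add, map_add, hx, hy]) (by simp) h hy

theorem extOp_mem (m : 𝓜(ℂ, X)) (k : H) : extOp π m k ∈ essSpace π := by
  obtain ⟨y, hy, z, hz, rfl⟩ := (essSpace π).exists_add_mem_mem_orthogonal k
  rw [map_add, extOp_apply_perp π m hz, add_zero]
  exact ess_induction π ((Submodule.isClosed_topologicalClosure _).preimage (extOp π m).continuous)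
    (fun x y hx hy => by rw [map_add]; exact add_mem hx hy)
    (by rw [map_zero]; exact zero_mem _) (fun x k => by rw [extOp_apply]; exact rep_mem_essSpace π _ _) hy

theorem extOp_star (m : 𝓜(ℂ, X)) : extOp π (star m) = star (extOp π m) := by
  have hperp : ∀ k ∈ (essSpace π)ᗮ, star (extOp π m) k = 0 := fun k hk => by
    refine ext_inner_left ℂ fun g => ?_
    rw [ContinuousLinearMap.star_eq_adjoint, ContinuousLinearMap.adjoint_inner_right, inner_zero_right]
    exact hk _ (extOp_mem π m g)
  refine op_ext π (fun x h => ?_) fun k hk => by rw [extOp_apply_perp π _ hk, hperp k hk]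
  refine ext_inner_left ℂ fun k => ?_
  rw [extOp_apply, ContinuousLinearMap.star_eq_adjoint, ContinuousLinearMap.adjoint_inner_right]
  obtain ⟨y, hy, z, hz, rfl⟩ := (essSpace π).exists_add_mem_mem_orthogonal k
  rw [map_add, extOp_apply_perp π m hz, inner_add_left, inner_add_left, inner_zero_left,
    Submodule.inner_left_of_mem_orthogonal (rep_mem_essSpace π _ _) hz]
  congr 1
  refine ess_induction π (p := fun y => ⟪y, π ((star m).fst x) h⟫_ℂ = ⟪extOp π m y, π x h⟫_ℂ)
    (isClosed_eq (by fun_prop) (by fun_prop)) (fun a b ha hb => by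
      simp only [map_add, inner_add_left, ha, hb]) (by simp) (fun a g => ?_) hy
  rw [extOp_apply, ← ContinuousLinearMap.adjoint_inner_right,
    ← ContinuousLinearMap.adjoint_inner_right, ← ContinuousLinearMap.star_eq_adjoint,
    ← ContinuousLinearMap.star_eq_adjoint, ← map_star, ← map_star, ← mul_apply_eq_comp,
    ← mul_apply_eq_comp, ← map_mul, ← map_mul, ← DoubleCentralizer.central]
  simp

/-- The canonical extension of a representation of a C⋆-algebra to its multiplier algebra. -/
def extRep : 𝓜(ℂ, X) →⋆ₙₐ[ℂ] (H →L[ℂ] H) where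
  toFun := extOp π
  map_smul' c m := op_ext π (fun x k => by simp [extOp_apply]) fun k hk => by
    simp [extOp_apply_perp π _ hk]
  map_zero' := op_ext π (fun x k => by simp [extOp_apply]) fun k hk => by
    simp [extOp_apply_perp π _ hk]
  map_add' m n := op_ext π (fun x k => by simp [extOp_apply]) fun k hk => by
    simp [extOp_apply_perp π _ hk]
  map_mul' m n := op_ext π (fun x k => by simp [extOp_apply]) fun k hk => by
    simp [extOp_apply_perp π _ hk]
  map_star' := extOp_star π

theorem extRep_mul (m : 𝓜(ℂ, X)) (x : X) : extRep π m * π x = π (m.fst x) :=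
  ContinuousLinearMap.ext fun h => extOp_apply π m x h

end ExtendRep

/-- A C⋆-algebra `T` presented as a spatial tensor product of `X` and `Y`: a dense linear image of
the algebraic tensor product together with a norming family of representations of `T`, each of
them unitarily equivalent to a subrepresentation of a tensor product of representations. -/
structure SpatialModel (X Y T : Type u) [NonUnitalCStarAlgebra X] [NonUnitalCStarAlgebra Y]
    [NonUnitalCStarAlgebra T] where
  toFun : X ⊗[ℂ] Y →ₗ[ℂ] T
  dense : DenseRange toFun
  Index : Type (u + 1)
  left : Index → HilbertRep X
  right : Index → HilbertRep Y
  mid : Index → HilbertRep T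
  iso : ∀ i, (mid i).Space →ₗᵢ[ℂ] HilbertTensor (left i).Space (right i).Space
  intertwine : ∀ i x y ξ, iso i ((mid i).rep (toFun (x ⊗ₜ y)) ξ) =
    opTensor ((left i).rep x) ((right i).rep y) (iso i ξ)
  norming : ∀ (t : T) (M : ℝ), 0 ≤ M → (∀ i, ‖(mid i).rep t‖ ≤ M) → ‖t‖ ≤ M

namespace SpatialModel

variable {X Y T : Type u} [NonUnitalCStarAlgebra X] [NonUnitalCStarAlgebra Y]
    [NonUnitalCStarAlgebra T] (S : SpatialModel X Y T)
  {A B : Type u} [NonUnitalCStarAlgebra A] [NonUnitalCStarAlgebra B]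
  (f : A →⋆ₙₐ[ℂ] 𝓜(ℂ, X)) (g : B →⋆ₙₐ[ℂ] 𝓜(ℂ, Y))

theorem ext_of_rep {s t : T} (h : ∀ i, (S.mid i).rep s = (S.mid i).rep t) : s = t := by
  rw [← sub_eq_zero, ← norm_le_zero_iff]
  exact S.norming _ _ le_rfl fun i => by simp [h]

/-- The left action of multipliers, as a linear map. -/
def fstₗ (X : Type u) [NonUnitalCStarAlgebra X] : 𝓜(ℂ, X) →ₗ[ℂ] (X →ₗ[ℂ] X) where
  toFun m := m.fst
  map_add' _ _ := rfl
  map_smul' _ _ := rfl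

/-- `z = ∑ a ⊗ b` acts on the dense image of `X ⊗ Y` by `x ⊗ y ↦ ∑ f(a) x ⊗ g(b) y`. -/
def preAct : A ⊗[ℂ] B →ₗ[ℂ] (X ⊗[ℂ] Y →ₗ[ℂ] T) :=
  (LinearMap.llcomp ℂ _ _ _ S.toFun) ∘ₗ TensorProduct.lift
    ((TensorProduct.mapBilinear (.id ℂ) X Y X Y).compl₁₂ (fstₗ X ∘ₗ (f : A →ₗ[ℂ] _))
      (fstₗ Y ∘ₗ (g : B →ₗ[ℂ] _)))

@[simp] theorem preAct_tmul (a : A) (b : B) (x : X) (y : Y) :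
    S.preAct f g (a ⊗ₜ b) (x ⊗ₜ y) = S.toFun ((f a).fst x ⊗ₜ (g b).fst y) := rfl

/-- The representation of `A ⊗ B` obtained by extending representations to multipliers. -/
def pullRep (i : S.Index) : MinTensor A B →⋆ₙₐ[ℂ]
    (HilbertTensor (S.left i).Space (S.right i).Space →L[ℂ]
      HilbertTensor (S.left i).Space (S.right i).Space) :=
  MinTensor.rep ⟨(S.left i).Space, (extRep (S.left i).rep).comp f⟩
    ⟨(S.right i).Space, (extRep (S.right i).rep).comp g⟩

theorem pullRep_tmul (i : S.Index) (a : A) (b : B) :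
    S.pullRep f g i (MinTensor.inc (a ⊗ₜ b)) =
      opTensor (extRep (S.left i).rep (f a)) (extRep (S.right i).rep (g b)) :=
  MinTensor.rep_inc _ _ _

theorem preAct_intertwine (i : S.Index) (z : A ⊗[ℂ] B) (w : X ⊗[ℂ] Y) (ξ : (S.mid i).Space) :
    S.iso i ((S.mid i).rep (S.preAct f g z w) ξ) =
      S.pullRep f g i (MinTensor.inc z) (S.iso i ((S.mid i).rep (S.toFun w) ξ)) := by
  induction z with
  | zero => simp
  | add x y hx hy => simp only [map_add, LinearMap.add_apply, add_apply, hx, hy]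
  | tmul a b =>
    induction w with
    | zero => simp
    | add x y hx hy => simp only [map_add, add_apply, hx, hy]
    | tmul x y =>
      rw [preAct_tmul, S.intertwine, S.intertwine, pullRep_tmul, ← extRep_mul, ← extRep_mul,
        opTensor_mul, mul_apply_eq_comp]

theorem norm_preAct_le (z : A ⊗[ℂ] B) (w : X ⊗[ℂ] Y) :
    ‖S.preAct f g z w‖ ≤ ‖MinTensor.inc z‖ * ‖S.toFun w‖ := by
  refine S.norming _ _ (by positivity) fun i => ?_
  refine ContinuousLinearMap.opNorm_le_bound _ (by positivity) fun ξ => ?_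
  rw [← (S.iso i).norm_map, preAct_intertwine]
  refine (ContinuousLinearMap.le_opNorm _ _).trans ?_
  rw [(S.iso i).norm_map, mul_assoc]
  refine mul_le_mul (NonUnitalStarAlgHom.norm_apply_le (S.pullRep f g i) (MinTensor.inc z)) ?_
    (norm_nonneg _) (norm_nonneg _)
  refine (ContinuousLinearMap.le_opNorm _ _).trans ?_
  gcongr
  exact NonUnitalStarAlgHom.norm_apply_le (S.mid i).rep _

/-- The action of `z` on `T`. -/
def act (z : A ⊗[ℂ] B) : T →L[ℂ] T := (S.preAct f g z).extendOfNorm S.toFun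

theorem act_toFun (z : A ⊗[ℂ] B) (w : X ⊗[ℂ] Y) : S.act f g z (S.toFun w) = S.preAct f g z w :=
  LinearMap.extendOfNorm_eq S.dense ⟨_, S.norm_preAct_le f g z⟩ w

theorem norm_act_le (z : A ⊗[ℂ] B) : ‖S.act f g z‖ ≤ ‖MinTensor.inc z‖ :=
  ContinuousLinearMap.opNorm_le_bound _ (norm_nonneg (MinTensor.inc z)) fun t =>
    LinearMap.norm_extendOfNorm_apply_le S.dense _ (S.norm_preAct_le f g z) t

theorem continuous_mid (i : S.Index) (ξ : (S.mid i).Space) :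
    Continuous fun t => (S.mid i).rep t ξ :=
  (continuous_starHom (S.mid i).rep).clm_apply continuous_const

theorem act_intertwine (i : S.Index) (z : A ⊗[ℂ] B) (t : T) (ξ : (S.mid i).Space) :
    S.iso i ((S.mid i).rep (S.act f g z t) ξ) =
      S.pullRep f g i (MinTensor.inc z) (S.iso i ((S.mid i).rep t ξ)) := by
  refine S.dense.induction_on (p := fun t => S.iso i ((S.mid i).rep (S.act f g z t) ξ) =
      S.pullRep f g i (MinTensor.inc z) (S.iso i ((S.mid i).rep t ξ))) t ?_ fun w => ?_
  · exact isClosed_eq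
      ((S.iso i).continuous.comp ((S.continuous_mid i ξ).comp (S.act f g z).continuous))
      ((S.pullRep f g i (MinTensor.inc z)).continuous.comp
        ((S.iso i).continuous.comp (S.continuous_mid i ξ)))
  · rw [act_toFun, preAct_intertwine]

theorem act_ext {U V : T →L[ℂ] T} (h : ∀ i t ξ, S.iso i ((S.mid i).rep (U t) ξ) =
    S.iso i ((S.mid i).rep (V t) ξ)) : U = V :=
  ContinuousLinearMap.ext fun t => S.ext_of_rep fun i => ContinuousLinearMap.ext fun ξ =>
    (S.iso i).injective (h i t ξ)

theorem act_central (z : A ⊗[ℂ] B) (s t : T) :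
    star (S.act f g (star z) (star s)) * t = s * S.act f g z t := by
  refine S.ext_of_rep fun i => ?_
  refine ContinuousLinearMap.ext fun ξ => ext_inner_left ℂ fun η => ?_
  rw [map_mul, map_mul, map_star, mul_apply_eq_comp, mul_apply_eq_comp,
    ContinuousLinearMap.star_eq_adjoint, ContinuousLinearMap.adjoint_inner_right,
    ← (S.iso i).inner_map_map, act_intertwine]
  have h1 : MinTensor.inc (star z) = star (MinTensor.inc z) := map_star _ z
  rw [h1, map_star, map_star, ContinuousLinearMap.star_eq_adjoint,
    ContinuousLinearMap.adjoint_inner_left, ← act_intertwine, (S.iso i).inner_map_map,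
    ContinuousLinearMap.star_eq_adjoint, ContinuousLinearMap.adjoint_inner_left]

/-- The multiplier of `T` by which `z` acts. -/
def actMultiplier (z : A ⊗[ℂ] B) : 𝓜(ℂ, T) where
  fst := S.act f g z
  snd := (((starₗᵢ ℂ : T ≃ₗᵢ⋆[ℂ] T) : T →L⋆[ℂ] T).comp (S.act f g (star z))).comp
    ((starₗᵢ ℂ : T ≃ₗᵢ⋆[ℂ] T) : T →L⋆[ℂ] T)
  central := S.act_central f g z

theorem actMultiplier_fst (z : A ⊗[ℂ] B) (t : T) :
    (S.actMultiplier f g z).fst t = S.act f g z t := rfl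

def actHom : A ⊗[ℂ] B →⋆ₙₐ[ℂ] 𝓜(ℂ, T) where
  toFun := S.actMultiplier f g
  map_smul' c z := multiplier_ext fun t => by
    refine congrArg (fun U : T →L[ℂ] T => U t) (?_ : S.act f g (c • z) = c • S.act f g z)
    exact S.act_ext fun i t ξ => by
      simp only [smul_apply, map_smul, act_intertwine]
  map_zero' := multiplier_ext fun t => by
    refine congrArg (fun U : T →L[ℂ] T => U t) (?_ : S.act f g 0 = 0)
    exact S.act_ext fun i t ξ => by simp [act_intertwine]
  map_add' z w := multiplier_ext fun t => by
    refine congrArg (fun U : T →L[ℂ] T => U t) (?_ : S.act f g (z + w) = S.act f g z + S.act f g w)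
    exact S.act_ext fun i t ξ => by
      simp only [add_apply, map_add, act_intertwine]
  map_mul' z w := multiplier_ext fun t => by
    refine congrArg (fun U : T →L[ℂ] T => U t)
      (?_ : S.act f g (z * w) = S.act f g z * S.act f g w)
    refine S.act_ext fun i t ξ => ?_
    have h1 : MinTensor.inc (z * w) = MinTensor.inc z * MinTensor.inc w :=
      map_mul _ z w
    rw [mul_apply_eq_comp, act_intertwine, act_intertwine, act_intertwine, h1, map_mul,
      mul_apply_eq_comp]
  map_star' z := multiplier_ext fun t => by
    change S.act f g (star z) t = star (star (S.act f g (star z) (star (star t))))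
    simp

/-- For `*`-homomorphisms `f : A → M(X)` and `g : B → M(Y)`, the `*`-homomorphism
`f ⊗ g : A ⊗ B → M(T)`, where `T` is presented as a spatial tensor product of `X` and `Y`. -/
def tensorHom : MinTensor A B →⋆ₙₐ[ℂ] 𝓜(ℂ, T) :=
  RepFamily.Envelope.liftInc (S.actHom f g) fun z => by
    rw [← DoubleCentralizer.norm_fst]
    exact S.norm_act_le f g z

theorem tensorHom_tmul (a : A) (b : B) (x : X) (y : Y) :
    (S.tensorHom f g (MinTensor.inc (a ⊗ₜ b))).fst (S.toFun (x ⊗ₜ y)) =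
      S.toFun ((f a).fst x ⊗ₜ (g b).fst y) := by
  have h : S.tensorHom f g (MinTensor.inc (a ⊗ₜ b)) = S.actMultiplier f g (a ⊗ₜ b) :=
    RepFamily.Envelope.liftInc_inc (F := minFamily A B) (S.actHom f g) _ _
  rw [h, actMultiplier_fst, act_toFun, preAct_tmul]

end SpatialModel

section Assoc

variable {H K L : Type u}
  [NormedAddCommGroup H] [InnerProductSpace ℂ H] [NormedAddCommGroup K] [InnerProductSpace ℂ K]
  [NormedAddCommGroup L] [InnerProductSpace ℂ L]

namespace HilbertTensor

/-- Extension of an isometry to the completion. -/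
def liftIso {E : Type u} [NormedAddCommGroup E] [InnerProductSpace ℂ E] [CompleteSpace E]
    (j : H ⊗[ℂ] K →ₗᵢ[ℂ] E) : HilbertTensor H K →ₗᵢ[ℂ] E where
  toLinearMap := (ContinuousLinearMap.fromCompletion j.toContinuousLinearMap :
    HilbertTensor H K →L[ℂ] E).toLinearMap
  norm_map' := induction
    (isClosed_eq (ContinuousLinearMap.continuous _).norm continuous_norm) fun a =>
      (congrArg norm (ContinuousLinearMap.fromCompletion_apply_coe _ a)).trans
        ((j.norm_map a).trans (of.norm_map a).symm)

@[simp] theorem liftIso_of {E : Type u} [NormedAddCommGroup E] [InnerProductSpace ℂ E]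
    [CompleteSpace E] (j : H ⊗[ℂ] K →ₗᵢ[ℂ] E) (x : H ⊗[ℂ] K) : liftIso j (of x) = j x :=
  ContinuousLinearMap.fromCompletion_apply_coe j.toContinuousLinearMap x

/-- The identification of `H ⊗̂ K ⊗̂ L` with `H ⊗̂ (K ⊗̂ L)`. -/
def assocRight : HilbertTensor H (K ⊗[ℂ] L) →ₗᵢ[ℂ] HilbertTensor H (HilbertTensor K L) :=
  liftIso (of.comp ((of (H := K) (K := L)).lTensor H))

/-- The identification of `H ⊗̂ K ⊗̂ L` with `(H ⊗̂ K) ⊗̂ L`. -/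
def assocLeft : HilbertTensor H (K ⊗[ℂ] L) →ₗᵢ[ℂ] HilbertTensor (HilbertTensor H K) L :=
  liftIso (of.comp (((of (H := H) (K := K)).rTensor L).comp
    (TensorProduct.assocIsometry ℂ H K L).symm.toLinearIsometry))

@[simp] theorem assocRight_tmul (h : H) (k : K) (l : L) :
    assocRight (of (h ⊗ₜ (k ⊗ₜ l))) = of (h ⊗ₜ of (k ⊗ₜ l)) := by
  simp [assocRight]

@[simp] theorem assocLeft_tmul (h : H) (k : K) (l : L) :
    assocLeft (of (h ⊗ₜ (k ⊗ₜ l))) = of (of (h ⊗ₜ k) ⊗ₜ l) := by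
  simp [assocLeft]

theorem induction₃ {p : HilbertTensor H (K ⊗[ℂ] L) → Prop} (hc : IsClosed {x | p x}) (h0 : p 0)
    (hadd : ∀ x y, p x → p y → p (x + y)) (h : ∀ a b c, p (of (a ⊗ₜ (b ⊗ₜ c))))
    (x : HilbertTensor H (K ⊗[ℂ] L)) : p x := by
  refine induction hc (fun a => ?_) x
  induction a with
  | zero => simpa using h0
  | add x y hx hy => simpa using hadd _ _ hx hy
  | tmul a w =>
    induction w with
    | zero => simpa using h0
    | add x y hx hy => simpa [TensorProduct.tmul_add] using hadd _ _ hx hy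
    | tmul b c => exact h a b c

theorem assocRight_op (S : H →L[ℂ] H) (T : K →L[ℂ] K) (U : L →L[ℂ] L)
    (ξ : HilbertTensor H (K ⊗[ℂ] L)) :
    assocRight (opTensor S (TensorProduct.mapL T U) ξ) =
      opTensor S (opTensor T U) (assocRight ξ) := by
  refine induction₃ (p := fun ξ => assocRight (opTensor S (TensorProduct.mapL T U) ξ) =
      opTensor S (opTensor T U) (assocRight ξ)) ?_ (by simp)
    (fun x y hx hy => by simp only [map_add, hx, hy]) (fun a b c => ?_) ξ
  · exact isClosed_eq (assocRight.continuous.comp (ContinuousLinearMap.continuous _))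
      ((ContinuousLinearMap.continuous _).comp assocRight.continuous)
  · simp

theorem assocLeft_op (S : H →L[ℂ] H) (T : K →L[ℂ] K) (U : L →L[ℂ] L)
    (ξ : HilbertTensor H (K ⊗[ℂ] L)) :
    assocLeft (opTensor S (TensorProduct.mapL T U) ξ) =
      opTensor (opTensor S T) U (assocLeft ξ) := by
  refine induction₃ (p := fun ξ => assocLeft (opTensor S (TensorProduct.mapL T U) ξ) =
      opTensor (opTensor S T) U (assocLeft ξ)) ?_ (by simp)
    (fun x y hx hy => by simp only [map_add, hx, hy]) (fun a b c => ?_) ξ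
  · exact isClosed_eq (assocLeft.continuous.comp (ContinuousLinearMap.continuous _))
      ((ContinuousLinearMap.continuous _).comp assocLeft.continuous)
  · simp

end HilbertTensor
end Assoc

section Models

open HilbertTensor

variable {A B C : Type u} [NonUnitalCStarAlgebra A] [NonUnitalCStarAlgebra B]
  [NonUnitalCStarAlgebra C]

/-- The representation `π ⊗ σ`, as a bundled representation. -/
def HilbertRep.tensor (π : HilbertRep A) (σ : HilbertRep B) : HilbertRep (MinTensor A B) :=
  { Space := HilbertTensor π.Space σ.Space, rep := MinTensor.rep π σ }

/-- The representation `π ⊗ σ ⊗ τ`, as a bundled representation. -/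
def HilbertRep.tensor₃ (π : HilbertRep A) (σ : HilbertRep B) (τ : HilbertRep C) :
    HilbertRep (MinTensor₃ A B C) :=
  { Space := HilbertTensor π.Space (σ.Space ⊗[ℂ] τ.Space), rep := MinTensor₃.rep π σ τ }

theorem assocRight_rep (π : HilbertRep A) (σ : HilbertRep B) (τ : HilbertRep C) (a : A)
    (y : B ⊗[ℂ] C) (ξ : HilbertTensor π.Space (σ.Space ⊗[ℂ] τ.Space)) :
    assocRight (MinTensor₃.rep π σ τ (MinTensor₃.inc (a ⊗ₜ y)) ξ) =
      opTensor (π.rep a) (MinTensor.rep σ τ (MinTensor.inc y)) (assocRight ξ) := by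
  rw [MinTensor₃.rep_inc, MinTensor.rep_inc]
  induction y with
  | zero => simp [← opTensorₗ_apply]
  | add x y hx hy =>
    simp only [← opTensorₗ_apply] at hx hy ⊢
    simp only [TensorProduct.tmul_add, map_add, add_apply, hx, hy]
  | tmul b c => rw [tensorRep₃_tmul, tensorRep_tmul, assocRight_op]

/-- Inclusion of the algebraic tensor product, as a linear map. -/
def MinTensor₃.incₗ : A ⊗[ℂ] (B ⊗[ℂ] C) →ₗ[ℂ] MinTensor₃ A B C where
  toFun := MinTensor₃.inc
  map_add' := map_add _
  map_smul' := map_smul _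

/-- The element `x ⊗ c` of `A ⊗ B ⊗ C`, for `x` in the algebraic tensor product. -/
def assocInc : A ⊗[ℂ] B →ₗ[ℂ] C →ₗ[ℂ] MinTensor₃ A B C :=
  TensorProduct.curry (MinTensor₃.incₗ ∘ₗ (TensorProduct.assoc ℂ A B C).toLinearMap)

@[simp] theorem assocInc_tmul (a : A) (b : B) (c : C) :
    assocInc (a ⊗ₜ b) c = MinTensor₃.inc (a ⊗ₜ (b ⊗ₜ c)) := rfl

theorem assocLeft_rep (π : HilbertRep A) (σ : HilbertRep B) (τ : HilbertRep C)
    (x : A ⊗[ℂ] B) (c : C) (ξ : HilbertTensor π.Space (σ.Space ⊗[ℂ] τ.Space)) :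
    assocLeft (MinTensor₃.rep π σ τ (assocInc x c) ξ) =
      opTensor (MinTensor.rep π σ (MinTensor.inc x)) (τ.rep c) (assocLeft ξ) := by
  rw [MinTensor.rep_inc]
  induction x with
  | zero => simp [← opTensorₗ_apply]
  | add x y hx hy =>
    simp only [← opTensorₗ_apply] at hx hy ⊢
    simp only [map_add, LinearMap.add_apply, add_apply, hx, hy]
  | tmul a b => rw [assocInc_tmul, MinTensor₃.rep_inc, tensorRep₃_tmul, tensorRep_tmul, assocLeft_op]

theorem norm_le_of_iso {E E' : Type u} [NormedAddCommGroup E] [InnerProductSpace ℂ E]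
    [NormedAddCommGroup E'] [InnerProductSpace ℂ E'] (j : E →ₗᵢ[ℂ] E') (S : E →L[ℂ] E)
    (T : E' →L[ℂ] E') (h : ∀ ξ, j (S ξ) = T (j ξ)) : ‖S‖ ≤ ‖T‖ :=
  S.opNorm_le_bound T.opNorm_nonneg fun ξ => by
    rw [← j.norm_map, h, ← j.norm_map ξ]
    exact T.le_opNorm _

theorem norm_inc_tmul_le (a : A) (y : B ⊗[ℂ] C) :
    ‖MinTensor₃.inc (a ⊗ₜ[ℂ] y)‖ ≤ ‖a‖ * ‖(MinTensor.inc y : MinTensor B C)‖ :=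
  MinTensor₃.norm_le _ (by positivity) fun π σ τ =>
    (norm_le_of_iso assocRight _ _ (assocRight_rep π σ τ a y)).trans
      ((norm_opTensor_le _ _).trans (mul_le_mul (NonUnitalStarAlgHom.norm_apply_le π.rep a)
        (NonUnitalStarAlgHom.norm_apply_le (MinTensor.rep σ τ) (MinTensor.inc y))
        (norm_nonneg _) (norm_nonneg _)))

theorem norm_assocInc_le (x : A ⊗[ℂ] B) (c : C) :
    ‖assocInc x c‖ ≤ ‖(MinTensor.inc x : MinTensor A B)‖ * ‖c‖ :=
  MinTensor₃.norm_le _ (by positivity) fun π σ τ =>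
    (norm_le_of_iso assocLeft _ _ (assocLeft_rep π σ τ x c)).trans
      ((norm_opTensor_le _ _).trans (mul_le_mul
        (NonUnitalStarAlgHom.norm_apply_le (MinTensor.rep π σ) (MinTensor.inc x))
        (NonUnitalStarAlgHom.norm_apply_le τ.rep c)
        (norm_nonneg _) (norm_nonneg _)))

theorem MinTensor.clm_ext {D : Type*} [NormedAddCommGroup D] [NormedSpace ℂ D]
    {S T : MinTensor A B →L[ℂ] D} (h : ∀ a : A ⊗[ℂ] B, S (MinTensor.inc a) = T (MinTensor.inc a)) :
    S = T := RepFamily.Envelope.clm_ext h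

theorem MinTensor.denseRange_inc : DenseRange (MinTensor.inc : A ⊗[ℂ] B → MinTensor A B) :=
  RepFamily.Envelope.denseRange_inc

/-- Extension of a bounded linear map from the algebraic tensor product. -/
def MinTensor.extend {D : Type*} [NormedAddCommGroup D] [NormedSpace ℂ D] [CompleteSpace D]
    (φ : A ⊗[ℂ] B →ₗ[ℂ] D) : MinTensor A B →L[ℂ] D :=
  φ.extendOfNorm (MinTensor.inc : A ⊗[ℂ] B →⋆ₙₐ[ℂ] MinTensor A B)

theorem MinTensor.extend_inc {D : Type*} [NormedAddCommGroup D] [NormedSpace ℂ D] [CompleteSpace D]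
    {φ : A ⊗[ℂ] B →ₗ[ℂ] D} {M : ℝ} (h : ∀ x, ‖φ x‖ ≤ M * ‖(MinTensor.inc x : MinTensor A B)‖)
    (x : A ⊗[ℂ] B) : MinTensor.extend φ (MinTensor.inc x) = φ x :=
  LinearMap.extendOfNorm_eq
    (e := ((MinTensor.inc : A ⊗[ℂ] B →⋆ₙₐ[ℂ] MinTensor A B) : A ⊗[ℂ] B →ₗ[ℂ] MinTensor A B))
    MinTensor.denseRange_inc ⟨M, h⟩ x

/-- The inclusion of the algebraic tensor product, as a bilinear map `A × (B ⊗ C) → A ⊗ B ⊗ C`. -/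
def inc₃ : A →ₗ[ℂ] B ⊗[ℂ] C →ₗ[ℂ] MinTensor₃ A B C :=
  TensorProduct.curry MinTensor₃.incₗ

theorem extend_inc₃ (a : A) (y : B ⊗[ℂ] C) :
    MinTensor.extend (inc₃ a) (MinTensor.inc y) = inc₃ a y :=
  MinTensor.extend_inc (norm_inc_tmul_le a) y

theorem extend_assocInc (c : C) (x : A ⊗[ℂ] B) :
    MinTensor.extend (assocInc.flip c) (MinTensor.inc x) = assocInc x c :=
  MinTensor.extend_inc (φ := assocInc.flip c)
    (fun x => (norm_assocInc_le x c).trans_eq (mul_comm _ _)) x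

/-- The bilinear map `A × (B ⊗ C) → A ⊗ B ⊗ C`. -/
def mulRight₃ : A →ₗ[ℂ] (MinTensor B C →L[ℂ] MinTensor₃ A B C) where
  toFun a := MinTensor.extend (inc₃ a)
  map_add' a b := MinTensor.clm_ext fun x => by
    rw [add_apply, extend_inc₃, extend_inc₃, extend_inc₃, map_add, LinearMap.add_apply]
  map_smul' c a := MinTensor.clm_ext fun x => by
    rw [smul_apply, extend_inc₃, extend_inc₃, map_smul, LinearMap.smul_apply]
    rfl

theorem mulRight₃_inc (a : A) (y : B ⊗[ℂ] C) :
    mulRight₃ a (MinTensor.inc y) = MinTensor₃.inc (a ⊗ₜ y) := extend_inc₃ a y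

/-- The bilinear map `(A ⊗ B) × C → A ⊗ B ⊗ C`. -/
def mulLeft₃ : C →ₗ[ℂ] (MinTensor A B →L[ℂ] MinTensor₃ A B C) where
  toFun c := MinTensor.extend (assocInc.flip c)
  map_add' a b := MinTensor.clm_ext fun x => by
    rw [add_apply, extend_assocInc, extend_assocInc, extend_assocInc, map_add]
  map_smul' c a := MinTensor.clm_ext fun x => by
    rw [smul_apply, extend_assocInc, extend_assocInc, map_smul]
    rfl

theorem mulLeft₃_inc (x : A ⊗[ℂ] B) (c : C) :
    mulLeft₃ c (MinTensor.inc x) = assocInc x c := extend_assocInc c x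

theorem MinTensor₃.denseRange_inc :
    DenseRange (MinTensor₃.inc : A ⊗[ℂ] (B ⊗[ℂ] C) → MinTensor₃ A B C) :=
  RepFamily.Envelope.denseRange_inc

theorem continuous_opTensor_right {H K : Type u}
    [NormedAddCommGroup H] [InnerProductSpace ℂ H] [NormedAddCommGroup K] [InnerProductSpace ℂ K]
    (S : H →L[ℂ] H) : Continuous fun T : K →L[ℂ] K => opTensor S T :=
  AddMonoidHomClass.continuous_of_bound (opTensorₗ S : (K →L[ℂ] K) →ₗ[ℂ] _) ‖S‖
    (norm_opTensor_le S)

theorem continuous_opTensor_left {H K : Type u}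
    [NormedAddCommGroup H] [InnerProductSpace ℂ H] [NormedAddCommGroup K] [InnerProductSpace ℂ K]
    (T : K →L[ℂ] K) : Continuous fun S : H →L[ℂ] H => opTensor S T :=
  AddMonoidHomClass.continuous_of_bound (opTensorₗ.flip T : (H →L[ℂ] H) →ₗ[ℂ] _) ‖T‖
    fun S => (norm_opTensor_le S T).trans_eq (mul_comm _ _)

/-- `A ⊗ B ⊗ C` as the spatial tensor product of `A` and `B ⊗ C`. -/
def modelRight (A B C : Type u) [NonUnitalCStarAlgebra A] [NonUnitalCStarAlgebra B]
    [NonUnitalCStarAlgebra C] : SpatialModel A (MinTensor B C) (MinTensor₃ A B C) where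
  toFun := TensorProduct.lift ((ContinuousLinearMap.coeLM ℂ) ∘ₗ mulRight₃)
  dense := by
    refine MinTensor₃.denseRange_inc.mono ?_
    rintro _ ⟨x, rfl⟩
    induction x with
    | zero => exact ⟨0, by simp⟩
    | add x y hx hy =>
      obtain ⟨v, hv⟩ := hx
      obtain ⟨w, hw⟩ := hy
      exact ⟨v + w, by simp only [map_add, hv, hw]⟩
    | tmul a y => exact ⟨a ⊗ₜ MinTensor.inc y, mulRight₃_inc a y⟩
  Index := HilbertRep A × HilbertRep B × HilbertRep C
  left i := i.1
  right i := i.2.1.tensor i.2.2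
  mid i := i.1.tensor₃ i.2.1 i.2.2
  iso i := assocRight (H := i.1.Space) (K := i.2.1.Space) (L := i.2.2.Space)
  intertwine i a t ξ := by
    change assocRight (MinTensor₃.rep i.1 i.2.1 i.2.2 (mulRight₃ a t) ξ) =
      opTensor (i.1.rep a) (MinTensor.rep i.2.1 i.2.2 t) (assocRight ξ)
    refine MinTensor.denseRange_inc.induction_on (p := fun t =>
      assocRight (MinTensor₃.rep i.1 i.2.1 i.2.2 (mulRight₃ a t) ξ) =
      opTensor (i.1.rep a) (MinTensor.rep i.2.1 i.2.2 t) (assocRight ξ)) t ?_ fun y => ?_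
    · exact isClosed_eq
        (assocRight.continuous.comp (((continuous_starHom _).comp
          (mulRight₃ a).continuous).clm_apply continuous_const))
        (((continuous_opTensor_right _).comp (continuous_starHom _)).clm_apply continuous_const)
    · rw [mulRight₃_inc]
      exact assocRight_rep i.1 i.2.1 i.2.2 a y ξ
  norming t M hM h := MinTensor₃.norm_le t hM fun π σ τ => h (π, σ, τ)

/-- `A ⊗ B ⊗ C` as the spatial tensor product of `A ⊗ B` and `C`. -/
def modelLeft (A B C : Type u) [NonUnitalCStarAlgebra A] [NonUnitalCStarAlgebra B]
    [NonUnitalCStarAlgebra C] : SpatialModel (MinTensor A B) C (MinTensor₃ A B C) where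
  toFun := TensorProduct.lift ((ContinuousLinearMap.coeLM ℂ) ∘ₗ mulLeft₃).flip
  dense := by
    refine MinTensor₃.denseRange_inc.mono ?_
    rintro _ ⟨x, rfl⟩
    induction x with
    | zero => exact ⟨0, by simp⟩
    | add x y hx hy =>
      obtain ⟨v, hv⟩ := hx
      obtain ⟨w, hw⟩ := hy
      exact ⟨v + w, by simp only [map_add, hv, hw]⟩
    | tmul a y =>
      induction y with
      | zero => exact ⟨0, by simp⟩
      | add x y hx hy =>
        obtain ⟨v, hv⟩ := hx
        obtain ⟨w, hw⟩ := hy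
        exact ⟨v + w, by simp only [TensorProduct.tmul_add, map_add, hv, hw]⟩
      | tmul b c => exact ⟨MinTensor.inc (a ⊗ₜ b) ⊗ₜ c, mulLeft₃_inc (a ⊗ₜ b) c⟩
  Index := HilbertRep A × HilbertRep B × HilbertRep C
  left i := i.1.tensor i.2.1
  right i := i.2.2
  mid i := i.1.tensor₃ i.2.1 i.2.2
  iso i := assocLeft (H := i.1.Space) (K := i.2.1.Space) (L := i.2.2.Space)
  intertwine i t c ξ := by
    change assocLeft (MinTensor₃.rep i.1 i.2.1 i.2.2 (mulLeft₃ c t) ξ) =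
      opTensor (MinTensor.rep i.1 i.2.1 t) (i.2.2.rep c) (assocLeft ξ)
    refine MinTensor.denseRange_inc.induction_on (p := fun t =>
      assocLeft (MinTensor₃.rep i.1 i.2.1 i.2.2 (mulLeft₃ c t) ξ) =
      opTensor (MinTensor.rep i.1 i.2.1 t) (i.2.2.rep c) (assocLeft ξ)) t ?_ fun y => ?_
    · exact isClosed_eq
        (assocLeft.continuous.comp (((continuous_starHom _).comp
          (mulLeft₃ c).continuous).clm_apply continuous_const))
        (((continuous_opTensor_left _).comp (continuous_starHom _)).clm_apply continuous_const)
    · rw [mulLeft₃_inc]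
      exact assocLeft_rep i.1 i.2.1 i.2.2 y c ξ
  norming t M hM h := MinTensor₃.norm_le t hM fun π σ τ => h (π, σ, τ)

end Models

section Maps

variable {X Y C D A B : Type u} [NonUnitalCStarAlgebra X] [NonUnitalCStarAlgebra Y]
  [NonUnitalCStarAlgebra C] [NonUnitalCStarAlgebra D] [NonUnitalCStarAlgebra A]
  [NonUnitalCStarAlgebra B]

/-- A `*`-homomorphism `f : X → M(Y)` is nondegenerate if `f(X) Y` and `Y f(X)` span dense
subspaces of `Y`. -/
def Nondegenerate (f : X →⋆ₙₐ[ℂ] 𝓜(ℂ, Y)) : Prop :=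
  (Submodule.span ℂ {z : Y | ∃ x y, z = (f x).fst y}).topologicalClosure = ⊤ ∧
  (Submodule.span ℂ {z : Y | ∃ x y, z = (f x).snd y}).topologicalClosure = ⊤

/-- `n ∈ M(Y)` is the value at `m ∈ M(X)` of the extension of `g : X → M(Y)` to multipliers:
`n g(x) = g(m x)` and `g(x) n = g(x m)` for all `x ∈ X`. If `g` is nondegenerate, there is exactly
one such `n`, which is the value at `m` of the unique strictly continuous extension
`M(X) → M(Y)` of `g`. -/
def IsMultiplierExtension (g : X →⋆ₙₐ[ℂ] 𝓜(ℂ, Y)) (m : 𝓜(ℂ, X)) (n : 𝓜(ℂ, Y)) : Prop :=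
  ∀ x : X, n * g x = g (m.fst x) ∧ g x * n = g (m.snd x)

/-- The canonical embedding `X → M(X)`. -/
def toMultiplier (X : Type u) [NonUnitalCStarAlgebra X] : X →⋆ₙₐ[ℂ] 𝓜(ℂ, X) :=
  DoubleCentralizer.coeHom

theorem toMultiplier_fst (x y : X) : (toMultiplier X x).fst y = x * y := rfl

theorem toMultiplier_snd (x y : X) : (toMultiplier X x).snd y = y * x := rfl

theorem isMultiplierExtension_comp_iff (h : X →⋆ₙₐ[ℂ] Y) (m : 𝓜(ℂ, X)) (n : 𝓜(ℂ, Y)) :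
    IsMultiplierExtension ((toMultiplier Y).comp h) m n ↔
      ∀ x : X, n.fst (h x) = h (m.fst x) ∧ n.snd (h x) = h (m.snd x) := by
  refine forall_congr' fun x => and_congr ?_ ?_
  · constructor
    · intro e
      refine sub_eq_zero.1 (norm_eq_zero.1 (mul_self_eq_zero.1 ?_))
      have key : ∀ y, n.fst (h x) * y = h (m.fst x) * y := fun y => by
        have := congrArg (fun p : 𝓜(ℂ, Y) => p.fst y) e
        rw [← fst_mul]
        exact this
      rw [← CStarRing.norm_self_mul_star, sub_mul, key, sub_self, norm_zero]
    · intro e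
      refine multiplier_ext fun y => ?_
      change n.fst (h x * y) = h (m.fst x) * y
      rw [fst_mul, e]
  · constructor
    · intro e
      refine sub_eq_zero.1 (norm_eq_zero.1 (mul_self_eq_zero.1 ?_))
      have key : ∀ y, n.snd (h x) * y = h (m.snd x) * y := fun y => by
        rw [n.central]
        exact congrArg (fun p : 𝓜(ℂ, Y) => p.fst y) e
      rw [← CStarRing.norm_self_mul_star, sub_mul, key, sub_self, norm_zero]
    · intro e
      refine multiplier_ext fun y => ?_
      change h x * n.fst y = h (m.snd x) * y
      rw [← n.central, e]

/-- `id ⊗ f` on the algebraic tensor product. -/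
def mapRightAlg (C : Type u) [NonUnitalCStarAlgebra C] (f : A →⋆ₙₐ[ℂ] B) :
    C ⊗[ℂ] A →⋆ₙₐ[ℂ] C ⊗[ℂ] B :=
  liftStarHom ((TensorProduct.mk ℂ C B).compl₂ (f : A →ₗ[ℂ] B))
    (fun a a' b b' => by simp) (fun a b => by simp [map_star])

theorem mapRightAlg_tmul (f : A →⋆ₙₐ[ℂ] B) (c : C) (a : A) :
    mapRightAlg C f (c ⊗ₜ a) = c ⊗ₜ f a := rfl

theorem tensorRep_mapRightAlg (f : A →⋆ₙₐ[ℂ] B) (π : HilbertRep C) (σ : HilbertRep B)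
    (z : C ⊗[ℂ] A) : tensorRep π.rep σ.rep (mapRightAlg C f z) =
      tensorRep π.rep (σ.rep.comp f) z := by
  induction z with
  | zero => simp
  | add x y hx hy => simp only [map_add, hx, hy]
  | tmul c a => rfl

/-- The `*`-homomorphism `id ⊗ f : C ⊗ A → C ⊗ B` of minimal tensor products. -/
def MinTensor.mapRight (C : Type u) [NonUnitalCStarAlgebra C] (f : A →⋆ₙₐ[ℂ] B) :
    MinTensor C A →⋆ₙₐ[ℂ] MinTensor C B :=
  RepFamily.Envelope.liftInc (F := minFamily C A) (MinTensor.inc.comp (mapRightAlg C f)) fun z =>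
    RepFamily.Envelope.norm_inc_le (F := minFamily C B) _ (norm_nonneg _) fun i => by
      refine (congrArg norm (tensorRep_mapRightAlg f i.1 i.2 z)).le.trans ?_
      exact RepFamily.Envelope.norm_rep_le_inc (F := minFamily C A)
        (i.1, ⟨i.2.Space, i.2.rep.comp f⟩) z

theorem MinTensor.mapRight_inc (f : A →⋆ₙₐ[ℂ] B) (z : C ⊗[ℂ] A) :
    MinTensor.mapRight C f (MinTensor.inc z) = MinTensor.inc (mapRightAlg C f z) :=
  RepFamily.Envelope.liftInc_inc (F := minFamily C A) _ _ z

theorem MinTensor.hom_ext {f g : MinTensor C A →⋆ₙₐ[ℂ] X}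
    (h : ∀ c a, f (MinTensor.inc (c ⊗ₜ a)) = g (MinTensor.inc (c ⊗ₜ a))) : f = g := by
  ext t
  refine MinTensor.denseRange_inc.induction_on (p := fun t => f t = g t) t
    (isClosed_eq (continuous_starHom f) (continuous_starHom g)) fun z => ?_
  induction z with
  | zero => simp
  | add x y hx hy => simp only [map_add, hx, hy]
  | tmul c a => exact h c a

theorem MinTensor.mapRight_id :
    MinTensor.mapRight C (NonUnitalStarAlgHom.id ℂ A) = NonUnitalStarAlgHom.id ℂ _ :=
  MinTensor.hom_ext fun c a => by rw [MinTensor.mapRight_inc]; rfl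

theorem MinTensor.mapRight_comp (g : B →⋆ₙₐ[ℂ] D) (f : A →⋆ₙₐ[ℂ] B) :
    MinTensor.mapRight C (g.comp f) = (MinTensor.mapRight C g).comp (MinTensor.mapRight C f) :=
  MinTensor.hom_ext fun c a => by
    rw [MinTensor.mapRight_inc, NonUnitalStarAlgHom.comp_apply, MinTensor.mapRight_inc,
      MinTensor.mapRight_inc]
    rfl

/-- `id ⊗ ρ : C ⊗ A → M(C ⊗ C ⊗ A)`. -/
def idTensor (ρ : A →⋆ₙₐ[ℂ] 𝓜(ℂ, MinTensor C A)) :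
    MinTensor C A →⋆ₙₐ[ℂ] 𝓜(ℂ, MinTensor₃ C C A) :=
  (modelRight C C A).tensorHom (toMultiplier C) ρ

/-- `Δ ⊗ id : C ⊗ A → M(C ⊗ C ⊗ A)`. -/
def tensorId (A : Type u) [NonUnitalCStarAlgebra A] (Δ : C →⋆ₙₐ[ℂ] 𝓜(ℂ, MinTensor C C)) :
    MinTensor C A →⋆ₙₐ[ℂ] 𝓜(ℂ, MinTensor₃ C C A) :=
  (modelLeft C C A).tensorHom Δ (toMultiplier A)

/-- `(id ⊗ ρ) ρ = (Δ ⊗ id) ρ`, as maps `A → M(C ⊗ C ⊗ A)`, where `id ⊗ ρ` and `Δ ⊗ id` are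
extended to multipliers. -/
def Coassociative (Δ : C →⋆ₙₐ[ℂ] 𝓜(ℂ, MinTensor C C)) (ρ : A →⋆ₙₐ[ℂ] 𝓜(ℂ, MinTensor C A)) :
    Prop :=
  ∀ a, ∃ T : 𝓜(ℂ, MinTensor₃ C C A), IsMultiplierExtension (idTensor ρ) (ρ a) T ∧
    IsMultiplierExtension (tensorId A Δ) (ρ a) T

end Maps

section Slices

variable {C : Type u} [NonUnitalCStarAlgebra C]

/-- `S : C ⊗ C → C` is the slice map `ω ⊗ id`. -/
def IsLeftSliceMap (ω : C →L[ℂ] ℂ) (S : MinTensor C C →L[ℂ] C) : Prop :=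
  ∀ a b, S (MinTensor.inc (a ⊗ₜ b)) = ω a • b

/-- `S : C ⊗ C → C` is the slice map `id ⊗ ω`. -/
def IsRightSliceMap (ω : C →L[ℂ] ℂ) (S : MinTensor C C →L[ℂ] C) : Prop :=
  ∀ a b, S (MinTensor.inc (a ⊗ₜ b)) = ω b • a

/-- The canonical approximate unit of a C⋆-algebra, as a filter. -/
def approxUnit (C : Type u) [NonUnitalCStarAlgebra C] : Filter C :=
  letI := CStarAlgebra.spectralOrder C
  haveI := CStarAlgebra.spectralOrderedRing C
  CStarAlgebra.approximateUnit C

/-- `x = (ω ⊗ id)(m)`, for `m ∈ M(C ⊗ C)`: for all `b`, the element `x b` is the limit of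
`(ω ⊗ id)(m (e ⊗ b))` along the approximate unit `e` of `C`. -/
def IsLeftSlice (ω : C →L[ℂ] ℂ) (m : 𝓜(ℂ, MinTensor C C)) (x : C) : Prop :=
  ∃ S, IsLeftSliceMap ω S ∧ ∀ b : C,
    Filter.Tendsto (fun e => S (m.fst (MinTensor.inc (e ⊗ₜ b)))) (approxUnit C) (nhds (x * b))

/-- `x = (id ⊗ ω)(m)`, for `m ∈ M(C ⊗ C)`: for all `b`, the element `x b` is the limit of
`(id ⊗ ω)(m (b ⊗ e))` along the approximate unit `e` of `C`. -/
def IsRightSlice (ω : C →L[ℂ] ℂ) (m : 𝓜(ℂ, MinTensor C C)) (x : C) : Prop :=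
  ∃ S, IsRightSliceMap ω S ∧ ∀ b : C,
    Filter.Tendsto (fun e => S (m.fst (MinTensor.inc (b ⊗ₜ e)))) (approxUnit C) (nhds (x * b))

end Slices

section Weights

open scoped ENNReal NNReal

/-- Positive functionals. -/
def IsPosFunctional {C : Type u} [NonUnitalCStarAlgebra C] (ω : C →L[ℂ] ℂ) : Prop :=
  ∀ a, ∃ r : ℝ≥0, ω (star a * a) = (r : ℝ)

variable (C : Type u) [NonUnitalCStarAlgebra C]

/-- The cone of positive elements. -/
def posCone : Set C := {x | ∃ y, x = star y * y}

/-- A weight on a C⋆-algebra: an additive and positively homogeneous function on the positive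
elements, with values in `[0, ∞]` (its values elsewhere are irrelevant). -/
structure Weight where
  toFun : C → ℝ≥0∞
  map_add : ∀ x ∈ posCone C, ∀ y ∈ posCone C, toFun (x + y) = toFun x + toFun y
  map_smul : ∀ r : ℝ≥0, ∀ x ∈ posCone C, toFun (((r : ℝ) : ℂ) • x) = r * toFun x

namespace Weight

variable {C} (φ : Weight C)

/-- A weight is proper if it is nonzero, lower semicontinuous and densely defined. -/
structure IsProper : Prop where
  ne_zero : ∃ x ∈ posCone C, φ.toFun x ≠ 0
  lsc : ∀ r : ℝ≥0, IsClosed {x | x ∈ posCone C ∧ φ.toFun x ≤ r}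
  dense : posCone C ⊆ closure {x | x ∈ posCone C ∧ φ.toFun x < ∞}

/-- A weight is faithful if it vanishes on no positive element but zero. -/
def IsFaithful : Prop := ∀ x ∈ posCone C, φ.toFun x = 0 → x = 0

/-- A GNS triple `(H, π, Λ)` of a weight `φ`. The domain of `Λ` is the left ideal
`{a | φ(a* a) < ∞}`. -/
structure GNS where
  Space : Type u
  [normed : NormedAddCommGroup Space]
  [inner : InnerProductSpace ℂ Space]
  [complete : CompleteSpace Space]
  rep : C →⋆ₙₐ[ℂ] (Space →L[ℂ] Space)
  domain : Submodule ℂ C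
  mem_domain : ∀ a, a ∈ domain ↔ φ.toFun (star a * a) < ∞
  toVec : domain →ₗ[ℂ] Space
  dense : DenseRange toVec
  norm_sq : ∀ a : domain, ENNReal.ofReal (‖toVec a‖ ^ 2) = φ.toFun (star (a : C) * a)
  rep_toVec : ∀ (x : C) (a b : domain), (b : C) = x * a → rep x (toVec a) = toVec b

attribute [instance] GNS.normed GNS.inner GNS.complete

variable {φ}

/-- The value `∑ ⟨ξₙ, T ξₙ⟩` of the functional given by a sequence of vectors, for `T ≥ 0`. -/
def vecSum {H : Type u} [NormedAddCommGroup H] [InnerProductSpace ℂ H] (ξ : ℕ → H)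
    (T : H →L[ℂ] H) : ℝ≥0∞ := ∑' n, ENNReal.ofReal (⟪ξ n, T (ξ n)⟫_ℂ).re

/-- The W⋆-lift of a proper weight `φ` to the von Neumann algebra `π(C)''`: on positive operators,
the supremum of all positive normal functionals `T ↦ ∑ ⟨ξₙ, T ξₙ⟩` whose restriction to `C` is
majorized by `φ`. -/
def GNS.wLift (W : φ.GNS) (T : W.Space →L[ℂ] W.Space) : ℝ≥0∞ :=
  ⨆ (ξ : ℕ → W.Space) (_ : Summable fun n => ‖ξ n‖ ^ 2)
    (_ : ∀ a ∈ posCone C, vecSum ξ (W.rep a) ≤ φ.toFun a), vecSum ξ T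

/-- The W⋆-lift is faithful on the von Neumann algebra `π(C)''`. -/
def GNS.IsFaithfulLift (W : φ.GNS) : Prop :=
  ∀ T ∈ Set.centralizer (Set.centralizer (Set.range W.rep)), T.IsPositive → W.wLift T = 0 → T = 0

variable (φ)

/-- Approximate KMS weights: proper weights whose W⋆-lift, in the GNS representation, is
faithful. -/
def IsApproxKMS : Prop := φ.IsProper ∧ ∃ W : φ.GNS, W.IsFaithfulLift

/-- Left invariance: `φ((ω ⊗ id) Δ(a)) = ω(1) φ(a)` for all positive functionals `ω` and all
positive `a` with `φ(a) < ∞`, where `ω(1) = ‖ω‖`. -/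
def IsLeftInvariant (Δ : C →⋆ₙₐ[ℂ] 𝓜(ℂ, MinTensor C C)) : Prop :=
  ∀ ω : C →L[ℂ] ℂ, IsPosFunctional ω → ∀ a ∈ posCone C, φ.toFun a < ∞ →
    ∀ x, IsLeftSlice ω (Δ a) x → φ.toFun x = ‖ω‖₊ * φ.toFun a

/-- Right invariance: `φ((id ⊗ ω) Δ(a)) = ω(1) φ(a)` for all positive functionals `ω` and all
positive `a` with `φ(a) < ∞`, where `ω(1) = ‖ω‖`. -/
def IsRightInvariant (Δ : C →⋆ₙₐ[ℂ] 𝓜(ℂ, MinTensor C C)) : Prop :=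
  ∀ ω : C →L[ℂ] ℂ, IsPosFunctional ω → ∀ a ∈ posCone C, φ.toFun a < ∞ →
    ∀ x, IsRightSlice ω (Δ a) x → φ.toFun x = ‖ω‖₊ * φ.toFun a

end Weight
end Weights

/-- A locally compact quantum group, given by its C⋆-algebra `C = C₀(𝔾)` of continuous functions
vanishing at infinity and its comultiplication. -/
structure LCQG where
  Carrier : Type u
  [cstar : NonUnitalCStarAlgebra Carrier]
  comul : Carrier →⋆ₙₐ[ℂ] 𝓜(ℂ, MinTensor Carrier Carrier)
  nondegenerate : Nondegenerate comul
  coassoc : Coassociative comul comul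
  left_slice : ∀ (ω : Carrier →L[ℂ] ℂ) (a : Carrier), ∃ x, IsLeftSlice ω (comul a) x
  right_slice : ∀ (ω : Carrier →L[ℂ] ℂ) (a : Carrier), ∃ x, IsRightSlice ω (comul a) x
  left_dense :
    (Submodule.span ℂ {x | ∃ ω a, IsLeftSlice ω (comul a) x}).topologicalClosure = ⊤
  right_dense :
    (Submodule.span ℂ {x | ∃ ω a, IsRightSlice ω (comul a) x}).topologicalClosure = ⊤
  left_haar : ∃ φ : Weight Carrier, φ.IsFaithful ∧ φ.IsApproxKMS ∧ φ.IsLeftInvariant comul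
  right_haar : ∃ φ : Weight Carrier, φ.IsApproxKMS ∧ φ.IsRightInvariant comul

attribute [instance] LCQG.cstar

variable (G : LCQG.{u})

/-- An action of `𝔾` on a unital C⋆-algebra `A`. -/
@[ext]
structure Action (A : Type u) [CStarAlgebra A] where
  toHom : A →⋆ₙₐ[ℂ] 𝓜(ℂ, MinTensor G.Carrier A)
  nondegenerate : Nondegenerate toHom
  coassoc : Coassociative G.comul toHom
  continuous : (Submodule.span ℂ {x : MinTensor G.Carrier A |
    ∃ a c, x = (toHom a).fst (MinTensor.inc (c ⊗ₜ 1))}).topologicalClosure = ⊤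

variable {G}

section Equivariant

variable {A B D : Type u} [CStarAlgebra A] [CStarAlgebra B] [CStarAlgebra D]

/-- Equivariance of a unital `*`-homomorphism `f : A → B`: `ρ_B ∘ f = (id ⊗ f) ∘ ρ_A`, where
`id ⊗ f` is extended to multipliers. -/
def Equivariant (ρ : Action G A) (σ : Action G B) (f : A →⋆ₐ[ℂ] B) : Prop :=
  ∀ a, IsMultiplierExtension
    ((toMultiplier _).comp (MinTensor.mapRight G.Carrier (f : A →⋆ₙₐ[ℂ] B)))
    (ρ.toHom a) (σ.toHom (f a))

theorem Equivariant.id (ρ : Action G A) : Equivariant ρ ρ (StarAlgHom.id ℂ A) := fun a =>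
  (isMultiplierExtension_comp_iff _ _ _).2 fun x => by
    have h : MinTensor.mapRight G.Carrier ((StarAlgHom.id ℂ A : A →⋆ₐ[ℂ] A) : A →⋆ₙₐ[ℂ] A) =
      NonUnitalStarAlgHom.id ℂ _ := MinTensor.mapRight_id
    rw [h]
    exact ⟨rfl, rfl⟩

theorem Equivariant.comp {ρ : Action G A} {σ : Action G B} {τ : Action G D} {g : B →⋆ₐ[ℂ] D}
    {f : A →⋆ₐ[ℂ] B} (hg : Equivariant σ τ g) (hf : Equivariant ρ σ f) :
    Equivariant ρ τ (g.comp f) := fun a =>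
  (isMultiplierExtension_comp_iff _ _ _).2 fun x => by
    have h : MinTensor.mapRight G.Carrier ((g.comp f : A →⋆ₐ[ℂ] D) : A →⋆ₙₐ[ℂ] D) =
      (MinTensor.mapRight G.Carrier (g : B →⋆ₙₐ[ℂ] D)).comp
        (MinTensor.mapRight G.Carrier (f : A →⋆ₙₐ[ℂ] B)) :=
      MinTensor.mapRight_comp (g : B →⋆ₙₐ[ℂ] D) (f : A →⋆ₙₐ[ℂ] B)
    have h1 := (isMultiplierExtension_comp_iff _ _ _).1 (hf a) x
    have h2 := (isMultiplierExtension_comp_iff _ _ _).1 (hg (f a))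
      (MinTensor.mapRight G.Carrier (f : A →⋆ₙₐ[ℂ] B) x)
    rw [h]
    exact ⟨h2.1.trans (congrArg _ h1.1), h2.2.trans (congrArg _ h1.2)⟩

end Equivariant

/-- A unital C⋆-algebra with an action of `𝔾`. -/
structure GCStar (G : LCQG.{u}) where
  Carrier : Type u
  [cstar : CStarAlgebra Carrier]
  action : Action G Carrier

attribute [instance] GCStar.cstar

namespace GCStar

/-- Equivariant unital `*`-homomorphisms. -/
@[ext]
structure Hom (A B : GCStar G) where
  toHom : A.Carrier →⋆ₐ[ℂ] B.Carrier
  equivariant : Equivariant A.action B.action toHom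

open CategoryTheory

instance : Category (GCStar G) where
  Hom := Hom
  id A := ⟨StarAlgHom.id ℂ A.Carrier, Equivariant.id A.action⟩
  comp f g := ⟨g.toHom.comp f.toHom, g.equivariant.comp f.equivariant⟩

/-- The class of surjective morphisms. -/
def surjections (G : LCQG.{u}) : MorphismProperty (GCStar G) :=
  fun _ _ f => Function.Surjective f.toHom

/-- The class of injective morphisms. -/
def injections (G : LCQG.{u}) : MorphismProperty (GCStar G) :=
  fun _ _ f => Function.Injective f.toHom

end GCStar

section Factorization

open CategoryTheory

/-- A factorization system `(E, M)` on a category: both classes are closed under composition and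
contain all isomorphisms, and every morphism factors as `e ≫ m` with `e ∈ E` and `m ∈ M`, uniquely
up to a unique isomorphism. -/
structure IsFactorizationSystem {𝒞 : Type*} [Category 𝒞] (E M : MorphismProperty 𝒞) : Prop where
  left_comp : E.IsStableUnderComposition
  right_comp : M.IsStableUnderComposition
  left_iso : MorphismProperty.isomorphisms 𝒞 ≤ E
  right_iso : MorphismProperty.isomorphisms 𝒞 ≤ M
  exists_factorization : ∀ {X Y : 𝒞} (f : X ⟶ Y), ∃ (Z : 𝒞) (e : X ⟶ Z) (m : Z ⟶ Y),
    E e ∧ M m ∧ e ≫ m = f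
  unique_factorization : ∀ {X Y Z₁ Z₂ : 𝒞} (e₁ : X ⟶ Z₁) (m₁ : Z₁ ⟶ Y) (e₂ : X ⟶ Z₂) (m₂ : Z₂ ⟶ Y),
    E e₁ → M m₁ → E e₂ → M m₂ → e₁ ≫ m₁ = e₂ ≫ m₂ →
    ∃! h : Z₁ ≅ Z₂, e₁ ≫ h.hom = e₂ ∧ h.hom ≫ m₂ = m₁

end Factorization

end QG

end

/-! Write C for `G.Carrier` and factor f : A → B through D = f(A) as f = i ∘ e, with e onto and i
injective. The range of a `*`-homomorphism of C⋆-algebras is closed (`isClosed_range_starHom`), so D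
is a C⋆-algebra and the only issue is its action.

Since id ⊗ e : C ⊗ A → C ⊗ D has dense and closed range, it is onto, and every multiplier of C ⊗ A
induces one of C ⊗ D (`pushHom`). Pushing ρ_A in this way gives a map A → M(C ⊗ D), which must be
shown to vanish on ker e. If e(a) = 0, then f(a) = 0, and equivariance of f gives, for x in C ⊗ A,
(id ⊗ i)((id ⊗ e)(ρ_A(a) x)) = ρ_B(f(a)) (id ⊗ f)(x) = 0. The minimal tensor product preserves
injectivity, so id ⊗ i can be cancelled and the pushed multiplier is zero. No exactness of C ⊗ (·)
is needed: the kernel of id ⊗ e may well be larger than C ⊗ ker e.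

Injectivity of id ⊗ i (`MinTensor.mapRight_injective`) rests on slice maps: those of vector
functionals separate the points of a minimal tensor product and intertwine id ⊗ i with i. Their
boundedness uses a representation attaining the norm of a given element, obtained from a norming
state by the GNS construction.

Nondegeneracy, coassociativity and the density condition are inherited by D because surjections
carry dense spans to dense spans and multiplier identities to multiplier identities. Surjectivity of
id ⊗ e also makes the action on D unique, and makes equivariance descend from g ∘ e to g
(`Equivariant.of_comp`). Hence the algebraic diagonal filling of a surjection against an injection
is automatically equivariant, and uniqueness of factorizations follows formally. -/

noncomputable section

namespace QG

/-! ### Norm-controlled lifts and closed ranges of `*`-homomorphisms -/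

section ClosedRange

variable {X Y : Type u} [NonUnitalCStarAlgebra X] [NonUnitalCStarAlgebra Y]

/-- Selfadjoint elements of the range lift to elements of at most the same norm. -/
theorem exists_lift_norm_le_of_isSelfAdjoint (φ : X →⋆ₙₐ[ℂ] Y) {x : X} (hx : IsSelfAdjoint x) :
    ∃ x', φ x' = φ x ∧ ‖x'‖ ≤ ‖φ x‖ := by
  set r := ‖φ x‖
  have hr : 0 ≤ r := norm_nonneg _
  -- Truncation to [-r, r]: it fixes the spectrum of φ(x), and bounds the norm of the element of X
  -- obtained by functional calculus.
  let g : ℝ → ℝ := fun t => max (-r) (min t r)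
  have hg : Continuous g := by fun_prop
  have hg0 : g 0 = 0 := by simp [g, hr]
  have hφx : IsSelfAdjoint (φ x) := hx.map φ
  refine ⟨cfcₙ g x, ?_, norm_cfcₙ_le fun t _ => ?_⟩
  · have h1 : φ (cfcₙ g x) = cfcₙ g (φ x) :=
      NonUnitalStarAlgHomClass.map_cfcₙ (S := ℂ) φ g x hg.continuousOn hg0
        (continuous_starHom φ) hx hφx
    rw [h1]
    conv_rhs => rw [← cfcₙ_id' ℝ (φ x)]
    -- Spectral values of φ(x) have modulus at most r = ‖φ(x)‖, where g is the identity.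
    refine cfcₙ_congr fun t ht => ?_
    have h2 : ‖t‖ ≤ r := by
      have := norm_apply_le_norm_cfcₙ (fun t : ℝ => t) (φ x) ht
      rwa [cfcₙ_id' ℝ (φ x)] at this
    have h3 := abs_le.1 h2
    simp [g, h3.1, h3.2]
  · exact abs_le.2 ⟨le_max_left _ _, max_le (by linarith) (min_le_right _ _)⟩

/-- The real and imaginary parts are lifted separately, each at no cost in norm; the factor 2 is the
triangle inequality. Any uniform constant would do for the closed range and for bounding induced
multipliers. -/
theorem exists_lift_norm_le (φ : X →⋆ₙₐ[ℂ] Y) (x : X) :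
    ∃ x', φ x' = φ x ∧ ‖x'‖ ≤ 2 * ‖φ x‖ := by
  obtain ⟨a, ha, ha'⟩ := exists_lift_norm_le_of_isSelfAdjoint φ (realPart x).2
  obtain ⟨b, hb, hb'⟩ := exists_lift_norm_le_of_isSelfAdjoint φ (imaginaryPart x).2
  have hreal (r : ℝ) (y : X) : φ (r • y) = r • φ y := by
    simpa using map_smul φ (r : ℂ) y
  have h1 : φ (realPart x : X) = realPart (φ x) := by
    rw [realPart_apply_coe, realPart_apply_coe, hreal, map_add, map_star]
  have h2 : φ (imaginaryPart x : X) = imaginaryPart (φ x) := by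
    rw [imaginaryPart_apply_coe, imaginaryPart_apply_coe, map_smul, hreal, map_sub, map_star]
  have h3 : ‖(realPart (φ x) : Y)‖ ≤ ‖φ x‖ := realPart.norm_le (φ x)
  have h4 : ‖(imaginaryPart (φ x) : Y)‖ ≤ ‖φ x‖ := imaginaryPart.norm_le (φ x)
  refine ⟨a + Complex.I • b, ?_, ?_⟩
  · rw [map_add, map_smul, ha, hb, h1, h2, realPart_add_I_smul_imaginaryPart]
  · refine (norm_add_le _ _).trans ?_
    rw [norm_smul, Complex.norm_I, one_mul]
    rw [h1] at ha'
    rw [h2] at hb'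
    linarith

/-- The range of a `*`-homomorphism of C⋆-algebras is closed. -/
theorem isClosed_range_starHom (φ : X →⋆ₙₐ[ℂ] Y) : IsClosed (Set.range φ) := by
  let F : NormedAddGroupHom X Y :=
    { toFun := φ
      map_add' := map_add φ
      bound' := ⟨1, fun x => by simpa using NonUnitalStarAlgHom.norm_apply_le φ x⟩ }
  -- Lifts with a uniform bound on the range extend, by summing a series in the complete space X, to
  -- lifts of points of its closure.
  have h : F.SurjectiveOnWith F.range 2 := by
    rintro _ ⟨x, rfl⟩
    exact exists_lift_norm_le φ x
  have h' := controlled_closure_of_complete two_pos one_pos h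
  refine isClosed_of_closure_subset fun y hy => ?_
  obtain ⟨x, hx, -⟩ := h' y (show y ∈ closure (F.range : Set Y) from hy)
  exact ⟨x, hx⟩

theorem surjective_of_denseRange (φ : X →⋆ₙₐ[ℂ] Y) (h : DenseRange φ) : Function.Surjective φ :=
  Set.range_eq_univ.1 ((isClosed_range_starHom φ).closure_eq ▸ h.closure_range)

end ClosedRange

/-! ### Norming states and representations that attain the norm -/

section States

variable {A : Type u} [CStarAlgebra A]

open scoped ComplexOrder

/-- The norm of a positive element lies in its spectrum, so 2‖x‖ lies in the spectrum of ‖x‖ · 1 +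
x. Equality in the triangle inequality lets a single functional norm both 1 and x. -/
theorem norm_algebraMap_norm_add [PartialOrder A] [StarOrderedRing A] [Nontrivial A] {x : A}
    (hx : 0 ≤ x) : ‖algebraMap ℝ A ‖x‖ + x‖ = ‖x‖ + ‖x‖ := by
  refine le_antisymm ((norm_add_le _ _).trans (by simp)) ?_
  have h := spectrum.norm_le_norm_of_mem ((spectrum.add_mem_add_iff (r := ‖x‖) (s := ‖x‖)).2
    (CStarAlgebra.norm_mem_spectrum_of_nonneg hx))
  rwa [Real.norm_of_nonneg (by positivity)] at h

/-- A norm-one functional with `φ 1 = 1` has nonnegative real part on positive elements. -/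
theorem re_apply_nonneg [PartialOrder A] [StarOrderedRing A] {φ : A →L[ℂ] ℂ} (hφ : ‖φ‖ ≤ 1)
    (h1 : φ 1 = 1) {x : A} (hx : 0 ≤ x) : 0 ≤ (φ x).re := by
  -- From 0 ≤ ‖x‖ · 1 - x ≤ ‖x‖ · 1. Applying φ confines φ(x) to the disc of centre and radius ‖x‖,
  -- which lies in the right half-plane.
  have h2 : ‖algebraMap ℝ A ‖x‖ - x‖ ≤ ‖x‖ := by
    refine (CStarAlgebra.norm_le_iff_le_algebraMap _ (norm_nonneg x)
      (sub_nonneg.2 (IsSelfAdjoint.of_nonneg hx).le_algebraMap_norm_self)).2 ?_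
    exact sub_le_self _ hx
  have h3 : ‖φ (algebraMap ℝ A ‖x‖ - x)‖ ≤ ‖x‖ :=
    (φ.le_of_opNorm_le hφ _).trans (by simpa using h2)
  have h4 : φ (algebraMap ℝ A ‖x‖ - x) = (‖x‖ : ℂ) - φ x := by
    rw [map_sub, Algebra.algebraMap_eq_smul_one, ← Complex.coe_smul, map_smul, h1, smul_eq_mul,
      mul_one]
  rw [h4] at h3
  have h5 := (Complex.re_le_norm _).trans h3
  rw [Complex.sub_re, Complex.ofReal_re] at h5
  linarith

/-- A state which attains the norm of a given positive element. -/
theorem exists_positiveFunctional [PartialOrder A] [StarOrderedRing A] [Nontrivial A] {x : A}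
    (hx : 0 ≤ x) : ∃ φ : A →ₚ[ℂ] ℂ, φ 1 = 1 ∧ φ x = (‖x‖ : ℂ) := by
  obtain ⟨ψ, hψ, hψx⟩ : ∃ ψ : A →L[ℂ] ℂ, ‖ψ‖ ≤ 1 ∧ ψ 1 = 1 ∧ ψ x = (‖x‖ : ℂ) := by
    -- For x = 0 the element ‖x‖ · 1 + x is zero and has no dual vector; a functional norming 1
    -- serves instead.
    rcases eq_or_ne x 0 with rfl | h0
    · obtain ⟨g, hg, hg'⟩ := exists_dual_vector ℂ (1 : A) (by simp)
      exact ⟨g, hg.le, by simpa using hg', by simp⟩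
    have hpos := norm_pos_iff.2 h0
    obtain ⟨g, hg, hg'⟩ := exists_dual_vector ℂ (algebraMap ℝ A ‖x‖ + x) (by
      rw [← norm_pos_iff, norm_algebraMap_norm_add hx]
      exact norm_pos_iff.2 (add_pos hpos hpos).ne')
    rw [norm_algebraMap_norm_add hx, map_add, Algebra.algebraMap_eq_smul_one, ← Complex.coe_smul,
      map_smul, smul_eq_mul] at hg'
    have h1 : ‖g 1‖ ≤ 1 := (g.le_of_opNorm_le hg.le _).trans (by simp)
    -- The sum ‖x‖ g(1) + g(x) equals 2‖x‖, while each summand has real part at most ‖x‖. Both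
    -- bounds are therefore attained.
    have h2 : ‖g x‖ ≤ ‖x‖ := (g.le_of_opNorm_le hg.le _).trans (by simp)
    have hre := congrArg Complex.re hg'
    have h1' := (Complex.re_le_norm _).trans h1
    have h2' := (Complex.re_le_norm _).trans h2
    simp only [Complex.add_re, Complex.re_ofReal_mul] at hre
    have h3 : (g 1).re = 1 := by
      refine le_antisymm h1' (le_of_mul_le_mul_left ?_ hpos)
      simp at hre
      linarith
    have h4 : (g x).re = ‖x‖ := by
      simp [h3] at hre
      linarith
    -- Passes from the equality of real parts to that of the complex values: the imaginary part has
    -- no room left.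
    have key : ∀ (z : ℂ) (r : ℝ), ‖z‖ ≤ r → z.re = r → z = r := fun z r hz hr => by
      have := Complex.sq_norm z
      rw [Complex.normSq_apply, hr] at this
      have h5 : ‖z‖ ^ 2 ≤ r ^ 2 := by gcongr
      have h6 : z.im = 0 := by nlinarith [mul_self_nonneg z.im]
      exact Complex.ext (by simpa using hr) (by simpa using h6)
    exact ⟨g, hg.le, by simpa using key _ 1 h1 h3, key _ _ h2 h4⟩
  -- The hermitian part of ψ. Only the real part of ψ is known to be nonnegative on positive
  -- elements; φ equals that real part on selfadjoint elements, hence is positive.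
  let φ : A →ₗ[ℂ] ℂ :=
    { toFun := fun y => (ψ y + star (ψ (star y))) / 2
      map_add' := fun y z => by simp only [star_add, map_add]; ring
      map_smul' := fun c y => by
        simp only [star_smul, map_smul, smul_eq_mul, star_mul', star_star, RingHom.id_apply]
        ring }
  have hφ : ∀ y, IsSelfAdjoint y → φ y = ((ψ y).re : ℂ) := fun y hy => by
    change (ψ y + star (ψ (star y))) / 2 = _
    rw [hy.star_eq, Complex.re_eq_add_conj]
    rfl
  refine ⟨⟨φ, fun y z hyz => ?_⟩, ?_, ?_⟩
  · rw [← sub_nonneg]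
    change 0 ≤ φ z - φ y
    rw [← map_sub, hφ _ (IsSelfAdjoint.of_nonneg (sub_nonneg.2 hyz))]
    exact_mod_cast re_apply_nonneg hψ hψx.1 (sub_nonneg.2 hyz)
  · exact (hφ _ (IsSelfAdjoint.one A)).trans (by rw [hψx.1]; simp)
  · exact (hφ _ (IsSelfAdjoint.of_nonneg hx)).trans (by rw [hψx.2]; simp)

/-- Some representation on a Hilbert space attains the norm of a given element. -/
theorem exists_hilbertRep_norm_le (a : A) : ∃ σ : HilbertRep A, ‖a‖ ≤ ‖σ.rep a‖ := by
  rcases subsingleton_or_nontrivial A with h | h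
  · exact ⟨⟨PUnit, 0⟩, by rw [Subsingleton.elim a 0, norm_zero]; exact norm_nonneg _⟩
  let _ := CStarAlgebra.spectralOrder A
  have _ := CStarAlgebra.spectralOrderedRing A
  -- A state with φ(a* a) = ‖a‖². In its GNS space the class ξ of 1 is a unit vector with ‖π(a) ξ‖²
  -- = φ(a* a).
  obtain ⟨φ, h1, h2⟩ := exists_positiveFunctional (star_mul_self_nonneg a)
  refine ⟨⟨φ.GNS, φ.gnsNonUnitalStarAlgHom⟩, ?_⟩
  let ξ : φ.GNS := (φ.toPreGNS 1 : φ.PreGNS)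
  have hn : ∀ b : A, ‖((φ.toPreGNS b : φ.PreGNS) : φ.GNS)‖ = √(φ (star b * b)).re := fun b => by
    rw [Completion.norm_coe, PositiveLinearMap.preGNS_norm_def]
    rfl
  have hξ : ‖ξ‖ = 1 := by
    rw [hn]
    simp [h1]
  have hv : φ.gnsNonUnitalStarAlgHom a ξ = ((φ.toPreGNS a : φ.PreGNS) : φ.GNS) := by
    rw [PositiveLinearMap.gnsNonUnitalStarAlgHom_apply_coe]
    simp
  have ha : ‖φ.gnsNonUnitalStarAlgHom a ξ‖ = ‖a‖ := by
    rw [hv, hn, h2, CStarRing.norm_star_mul_self]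
    simp
  calc ‖a‖ = ‖φ.gnsNonUnitalStarAlgHom a ξ‖ := ha.symm
    _ ≤ ‖φ.gnsNonUnitalStarAlgHom a‖ * ‖ξ‖ := ContinuousLinearMap.le_opNorm _ _
    _ = _ := by rw [hξ, mul_one]

end States

/-! ### Slice maps, and injectivity of id ⊗ f -/

section SliceMaps

open HilbertTensor

variable {C D B : Type u} [NonUnitalCStarAlgebra C] [CStarAlgebra D] [CStarAlgebra B]

/-- The slice map `ω ⊗ id : C ⊗ D → D` of the vector functional `ω = ⟨h', π(·) h⟩`, on the
algebraic tensor product. -/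
def vecSliceAlg (D : Type u) [CStarAlgebra D] (π : HilbertRep C) (h h' : π.Space) :
    C ⊗[ℂ] D →ₗ[ℂ] D :=
  TensorProduct.lift (LinearMap.lsmul ℂ D ∘ₗ
    ((innerSL ℂ h').toLinearMap ∘ₗ (ContinuousLinearMap.apply ℂ π.Space h).toLinearMap ∘ₗ
      (π.rep : C →ₗ[ℂ] (π.Space →L[ℂ] π.Space))))

theorem vecSliceAlg_tmul (π : HilbertRep C) (h h' : π.Space) (c : C) (d : D) :
    vecSliceAlg D π h h' (c ⊗ₜ d) = ⟪h', π.rep c h⟫_ℂ • d := rfl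

/-- On c ⊗ d both sides are ⟨h', π(c) h⟩ ⟨k', σ(d) k⟩. Matrix coefficients of slices are thus
coefficients of π ⊗ σ between elementary tensors, which yields both the boundedness of slices and
the separation of points. -/
theorem inner_rep_vecSliceAlg (π : HilbertRep C) (h h' : π.Space) (σ : HilbertRep D)
    (k k' : σ.Space) (z : C ⊗[ℂ] D) : ⟪k', σ.rep (vecSliceAlg D π h h' z) k⟫_ℂ =
      ⟪of (h' ⊗ₜ k'), MinTensor.rep π σ (MinTensor.inc z) (of (h ⊗ₜ k))⟫_ℂ := by
  rw [MinTensor.rep_inc]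
  induction z with
  | zero => simp
  | add x y hx hy => simp only [map_add, add_apply, inner_add_right, hx, hy]
  | tmul c d =>
    rw [vecSliceAlg_tmul, tensorRep_tmul, opTensor_of, LinearIsometry.inner_map_map]
    simp

/-- The norm of the slice is tested in a representation σ of D that attains it, where its
coefficients are dominated by ‖(π ⊗ σ)(z)‖, hence by the minimal norm. This bound is what lets
slices extend to the completion. -/
theorem norm_vecSliceAlg_le (π : HilbertRep C) (h h' : π.Space) (z : C ⊗[ℂ] D) :
    ‖vecSliceAlg D π h h' z‖ ≤ ‖h'‖ * ‖h‖ * ‖(MinTensor.inc z : MinTensor C D)‖ := by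
  obtain ⟨σ, hσ⟩ := exists_hilbertRep_norm_le (vecSliceAlg D π h h' z)
  refine hσ.trans (ContinuousLinearMap.opNorm_le_bound _ (by positivity) fun k => ?_)
  set k' := σ.rep (vecSliceAlg D π h h' z) k with hk'
  rcases (norm_nonneg k').eq_or_lt with h0 | h0
  · rw [← h0]
    positivity
  -- Multiplied by ‖k'‖, the left side is ⟨k', k'⟩, a coefficient of (π ⊗ σ)(z) between h ⊗ k and h'
  -- ⊗ k'. Cauchy–Schwarz returns one factor ‖k'‖, which cancels.
  refine le_of_mul_le_mul_left ?_ h0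
  have h1 : ‖k'‖ * ‖k'‖ = ‖⟪k', k'⟫_ℂ‖ := by
    rw [inner_self_eq_norm_sq_to_K]
    simp [sq]
  rw [h1]
  nth_rewrite 2 [hk']
  rw [inner_rep_vecSliceAlg]
  refine (norm_inner_le_norm _ _).trans ?_
  have h2 := ((MinTensor.rep π σ (MinTensor.inc z)).le_opNorm (of (h ⊗ₜ k))).trans
    (mul_le_mul_of_nonneg_right
      (NonUnitalStarAlgHom.norm_apply_le (MinTensor.rep π σ) (MinTensor.inc z)) (norm_nonneg _))
  rw [LinearIsometry.norm_map, TensorProduct.norm_tmul] at h2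
  rw [LinearIsometry.norm_map, TensorProduct.norm_tmul]
  calc _ ≤ ‖h'‖ * ‖k'‖ * (‖(MinTensor.inc z : MinTensor C D)‖ * (‖h‖ * ‖k‖)) := by gcongr
    _ = _ := by ring

/-- The slice map `ω ⊗ id : C ⊗ D → D` of the vector functional `ω = ⟨h', π(·) h⟩`. -/
def vecSlice (D : Type u) [CStarAlgebra D] (π : HilbertRep C) (h h' : π.Space) :
    MinTensor C D →L[ℂ] D :=
  MinTensor.extend (vecSliceAlg D π h h')

theorem vecSlice_inc (π : HilbertRep C) (h h' : π.Space) (z : C ⊗[ℂ] D) :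
    vecSlice D π h h' (MinTensor.inc z) = vecSliceAlg D π h h' z :=
  MinTensor.extend_inc (norm_vecSliceAlg_le π h h') z

theorem inner_rep_vecSlice (π : HilbertRep C) (h h' : π.Space) (σ : HilbertRep D)
    (k k' : σ.Space) (t : MinTensor C D) : ⟪k', σ.rep (vecSlice D π h h' t) k⟫_ℂ =
      ⟪of (h' ⊗ₜ k'), MinTensor.rep π σ t (of (h ⊗ₜ k))⟫_ℂ := by
  refine MinTensor.denseRange_inc.induction_on (p := fun t =>
    ⟪k', σ.rep (vecSlice D π h h' t) k⟫_ℂ =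
      ⟪of (h' ⊗ₜ k'), MinTensor.rep π σ t (of (h ⊗ₜ k))⟫_ℂ) t (isClosed_eq ?_ ?_) fun z => ?_
  · exact continuous_const.inner (((continuous_starHom σ.rep).comp
      (vecSlice D π h h').continuous).clm_apply continuous_const)
  · exact continuous_const.inner ((continuous_starHom (MinTensor.rep π σ)).clm_apply
      continuous_const)
  · rw [vecSlice_inc, inner_rep_vecSliceAlg]

/-- Slice maps of vector functionals separate the points of `C ⊗ D`. -/
theorem eq_zero_of_vecSlice {t : MinTensor C D}
    (ht : ∀ (π : HilbertRep C) (h h' : π.Space), vecSlice D π h h' t = 0) : t = 0 := by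
  refine RepFamily.Envelope.ext_of_rep (F := minFamily C D) fun i => ?_
  rw [map_zero]
  change MinTensor.rep i.1 i.2 t = 0
  -- An operator on the completed tensor product is determined by its coefficients between
  -- elementary tensors, and for (π ⊗ σ)(t) these are coefficients of slices of t.
  refine HilbertTensor.clm_ext fun x => ?_
  rw [zero_apply]
  induction x with
  | zero => simp
  | add x y hx hy => rw [map_add, map_add, hx, hy, add_zero]
  | tmul h k =>
    refine ext_inner_left ℂ fun y => ?_
    rw [inner_zero_right]
    refine HilbertTensor.induction (p := fun y =>
      ⟪y, MinTensor.rep i.1 i.2 t (of (h ⊗ₜ k))⟫_ℂ = 0)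
      (isClosed_eq (by fun_prop) continuous_const) (fun w => ?_) y
    induction w with
    | zero => simp
    | add x y hx hy => rw [map_add, inner_add_left, hx, hy, add_zero]
    | tmul h' k' => rw [← inner_rep_vecSlice, ht, map_zero, zero_apply, inner_zero_right]

theorem vecSlice_mapRight (f : D →⋆ₙₐ[ℂ] B) (π : HilbertRep C) (h h' : π.Space)
    (t : MinTensor C D) :
    vecSlice B π h h' (MinTensor.mapRight C f t) = f (vecSlice D π h h' t) := by
  refine MinTensor.denseRange_inc.induction_on (p := fun t =>
    vecSlice B π h h' (MinTensor.mapRight C f t) = f (vecSlice D π h h' t)) t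
    (isClosed_eq ((vecSlice B π h h').continuous.comp (continuous_starHom _))
      ((continuous_starHom f).comp (vecSlice D π h h').continuous)) fun z => ?_
  rw [MinTensor.mapRight_inc, vecSlice_inc, vecSlice_inc]
  induction z with
  | zero => simp
  | add x y hx hy => simp only [map_add, hx, hy]
  | tmul c d => rw [mapRightAlg_tmul, vecSliceAlg_tmul, vecSliceAlg_tmul, map_smul]

/-- The minimal tensor product preserves injectivity. -/
theorem MinTensor.mapRight_injective (C : Type u) [NonUnitalCStarAlgebra C] {f : D →⋆ₙₐ[ℂ] B}
    (hf : Function.Injective f) : Function.Injective (MinTensor.mapRight C f) := by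
  -- If (id ⊗ f)(t) = 0, then f kills every slice of t; so all slices vanish, and with them t.
  refine (injective_iff_map_eq_zero _).2 fun t ht => eq_zero_of_vecSlice fun π h h' => hf ?_
  rw [← vecSlice_mapRight, ht, map_zero, map_zero]

end SliceMaps

/-! ### Surjectivity of id ⊗ e -/

section Surjective

variable {C A D : Type u} [NonUnitalCStarAlgebra C] [NonUnitalCStarAlgebra A]
  [NonUnitalCStarAlgebra D]

/-- The range contains the algebraic tensor product, so it is dense; being the range of a
`*`-homomorphism it is also closed. -/
theorem MinTensor.mapRight_surjective (C : Type u) [NonUnitalCStarAlgebra C] {e : A →⋆ₙₐ[ℂ] D}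
    (he : Function.Surjective e) : Function.Surjective (MinTensor.mapRight C e) := by
  refine surjective_of_denseRange _ (MinTensor.denseRange_inc.mono ?_)
  rintro _ ⟨z, rfl⟩
  induction z with
  | zero => exact ⟨0, by simp⟩
  | add x y hx hy =>
    obtain ⟨v, hv⟩ := hx
    obtain ⟨w, hw⟩ := hy
    exact ⟨v + w, by rw [map_add, map_add, hv, hw]⟩
  | tmul c d =>
    obtain ⟨a, rfl⟩ := he d
    exact ⟨MinTensor.inc (c ⊗ₜ a), MinTensor.mapRight_inc e _⟩

end Surjective

/-! ### The map id ⊗ id ⊗ f on triple tensor products -/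

section MapRightThree

variable {C₁ C A D : Type u} [NonUnitalCStarAlgebra C₁] [NonUnitalCStarAlgebra C]
  [NonUnitalCStarAlgebra A] [NonUnitalCStarAlgebra D]

/-- `id ⊗ id ⊗ f` on the algebraic tensor product. -/
def mapRightAlg₃ (C₁ C : Type u) [NonUnitalCStarAlgebra C₁] [NonUnitalCStarAlgebra C]
    (f : A →⋆ₙₐ[ℂ] D) : C₁ ⊗[ℂ] (C ⊗[ℂ] A) →⋆ₙₐ[ℂ] C₁ ⊗[ℂ] (C ⊗[ℂ] D) :=
  liftStarHom (A := C₁) (B := C ⊗[ℂ] A) (D := C₁ ⊗[ℂ] (C ⊗[ℂ] D))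
    ((TensorProduct.mk ℂ C₁ (C ⊗[ℂ] D)).compl₂ (mapRightAlg C f : C ⊗[ℂ] A →ₗ[ℂ] C ⊗[ℂ] D))
    (fun a a' b b' => by simp) (fun a b => by simp [map_star])

theorem mapRightAlg₃_tmul (f : A →⋆ₙₐ[ℂ] D) (c : C₁) (x : C ⊗[ℂ] A) :
    mapRightAlg₃ C₁ C f (c ⊗ₜ x) = c ⊗ₜ mapRightAlg C f x := rfl

/-- Precomposing τ with f stays within the family that defines the norm on the source, so id ⊗ id ⊗
f is contractive. -/
theorem tensorRep₃_mapRightAlg₃ (f : A →⋆ₙₐ[ℂ] D) (π : HilbertRep C₁) (σ : HilbertRep C)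
    (τ : HilbertRep D) (z : C₁ ⊗[ℂ] (C ⊗[ℂ] A)) :
    tensorRep₃ π.rep σ.rep τ.rep (mapRightAlg₃ C₁ C f z) =
      tensorRep₃ π.rep σ.rep (τ.rep.comp f) z := by
  induction z with
  | zero => simp
  | add x y hx hy => simp only [map_add, hx, hy]
  | tmul c x =>
    induction x with
    | zero => simp
    | add x y hx hy => simp only [TensorProduct.tmul_add, map_add, hx, hy]
    | tmul b a => rfl

/-- The `*`-homomorphism `id ⊗ id ⊗ f` of minimal tensor products. -/
def MinTensor₃.mapRight (C₁ C : Type u) [NonUnitalCStarAlgebra C₁] [NonUnitalCStarAlgebra C]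
    (f : A →⋆ₙₐ[ℂ] D) : MinTensor₃ C₁ C A →⋆ₙₐ[ℂ] MinTensor₃ C₁ C D :=
  RepFamily.Envelope.liftInc (F := minFamily₃ C₁ C A)
    (MinTensor₃.inc.comp (mapRightAlg₃ C₁ C f)) fun z =>
    RepFamily.Envelope.norm_inc_le (F := minFamily₃ C₁ C D) _ (norm_nonneg _) fun i => by
      refine (congrArg norm (tensorRep₃_mapRightAlg₃ f i.1 i.2.1 i.2.2 z)).le.trans ?_
      exact RepFamily.Envelope.norm_rep_le_inc (F := minFamily₃ C₁ C A)
        (i.1, i.2.1, ⟨i.2.2.Space, i.2.2.rep.comp f⟩) z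

theorem MinTensor₃.mapRight_inc (f : A →⋆ₙₐ[ℂ] D) (z : C₁ ⊗[ℂ] (C ⊗[ℂ] A)) :
    MinTensor₃.mapRight C₁ C f (MinTensor₃.inc z) = MinTensor₃.inc (mapRightAlg₃ C₁ C f z) :=
  RepFamily.Envelope.liftInc_inc (F := minFamily₃ C₁ C A) _ _ z

theorem MinTensor₃.mapRight_surjective (C₁ C : Type u) [NonUnitalCStarAlgebra C₁]
    [NonUnitalCStarAlgebra C] {e : A →⋆ₙₐ[ℂ] D} (he : Function.Surjective e) :
    Function.Surjective (MinTensor₃.mapRight C₁ C e) := by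
  refine surjective_of_denseRange _ (MinTensor₃.denseRange_inc.mono ?_)
  rintro _ ⟨z, rfl⟩
  induction z with
  | zero => exact ⟨0, by simp⟩
  | add x y hx hy =>
    obtain ⟨v, hv⟩ := hx
    obtain ⟨w, hw⟩ := hy
    exact ⟨v + w, by rw [map_add, map_add, hv, hw]⟩
  | tmul c x =>
    induction x with
    | zero => exact ⟨0, by simp⟩
    | add x y hx hy =>
      obtain ⟨v, hv⟩ := hx
      obtain ⟨w, hw⟩ := hy
      exact ⟨v + w, by rw [map_add, TensorProduct.tmul_add, map_add, hv, hw]⟩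
    | tmul b d =>
      obtain ⟨a, rfl⟩ := he d
      exact ⟨MinTensor₃.inc (c ⊗ₜ (b ⊗ₜ a)), MinTensor₃.mapRight_inc e _⟩

/-- Naturality of `modelRight` in the last variable; `mapRight_mulLeft₃` is the counterpart for
`modelLeft`. Both are needed because id ⊗ ρ and Δ ⊗ id are described through the two different
bracketings. -/
theorem mapRight_mulRight₃ (f : A →⋆ₙₐ[ℂ] D) (c : C₁) (t : MinTensor C A) :
    MinTensor₃.mapRight C₁ C f (mulRight₃ c t) = mulRight₃ c (MinTensor.mapRight C f t) := by
  refine MinTensor.denseRange_inc.induction_on (p := fun t =>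
    MinTensor₃.mapRight C₁ C f (mulRight₃ c t) = mulRight₃ c (MinTensor.mapRight C f t)) t
    (isClosed_eq ((continuous_starHom _).comp (mulRight₃ c).continuous)
      ((mulRight₃ c).continuous.comp (continuous_starHom _))) fun y => ?_
  rw [mulRight₃_inc, MinTensor₃.mapRight_inc, MinTensor.mapRight_inc, mulRight₃_inc,
    mapRightAlg₃_tmul]

theorem mapRight_assocInc (f : A →⋆ₙₐ[ℂ] D) (x : C₁ ⊗[ℂ] C) (a : A) :
    MinTensor₃.mapRight C₁ C f (assocInc x a) = assocInc x (f a) := by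
  induction x with
  | zero => simp
  | add x y hx hy => simp only [map_add, LinearMap.add_apply, hx, hy]
  | tmul c b => rw [assocInc_tmul, assocInc_tmul, MinTensor₃.mapRight_inc]; rfl

theorem mapRight_mulLeft₃ (f : A →⋆ₙₐ[ℂ] D) (t : MinTensor C₁ C) (a : A) :
    MinTensor₃.mapRight C₁ C f (mulLeft₃ a t) = mulLeft₃ (f a) t := by
  refine MinTensor.denseRange_inc.induction_on (p := fun t =>
    MinTensor₃.mapRight C₁ C f (mulLeft₃ a t) = mulLeft₃ (f a) t) t
    (isClosed_eq ((continuous_starHom _).comp (mulLeft₃ a).continuous)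
      (mulLeft₃ (f a)).continuous) fun y => ?_
  rw [mulLeft₃_inc, mulLeft₃_inc, mapRight_assocInc]

end MapRightThree

/-! ### Multipliers and factorizations along a surjective `*`-homomorphism -/

section Push

variable {X Y : Type u} [NonUnitalCStarAlgebra X] [NonUnitalCStarAlgebra Y]

theorem multiplier_ext_of_denseRange {ι : Type*} {j : ι → X} (hj : DenseRange j) {m n : 𝓜(ℂ, X)}
    (h : ∀ i, m.fst (j i) = n.fst (j i)) : m = n :=
  multiplier_ext fun x => hj.induction_on (p := fun x => m.fst x = n.fst x) x
    (isClosed_eq m.fst.continuous n.fst.continuous) h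

theorem star_multiplier_fst (m : 𝓜(ℂ, X)) (x : X) : (star m).fst x = star (m.snd (star x)) := rfl

variable {φ : X →⋆ₙₐ[ℂ] Y} (hφ : Function.Surjective φ)

include hφ in
-- Centrality moves m to the other factor: φ(z) φ(m x) = φ(z m) φ(x) depends on x only through φ(x).
-- As the φ(z) exhaust Y, the ideal ker φ is stable under m.
theorem map_fst_congr (m : 𝓜(ℂ, X)) {x x' : X} (h : φ x = φ x') : φ (m.fst x) = φ (m.fst x') :=
  eq_of_forall_mul fun y => by
    obtain ⟨z, rfl⟩ := hφ y
    rw [← map_mul, ← map_mul, ← m.central, ← m.central, map_mul, map_mul, h]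

/-- The linear map on the target of a surjective `*`-homomorphism induced by a left multiplier. -/
def pushFst (m : 𝓜(ℂ, X)) : Y →L[ℂ] Y :=
  LinearMap.mkContinuous
    { toFun := fun y => φ (m.fst (Function.surjInv hφ y))
      map_add' := fun y z => by
        rw [← map_add, ← map_add]
        exact map_fst_congr hφ m (by simp only [map_add, Function.surjInv_eq])
      map_smul' := fun c y => by
        rw [RingHom.id_apply, ← map_smul, ← map_smul]
        exact map_fst_congr hφ m (by simp only [map_smul, Function.surjInv_eq]) }
    (‖m.fst‖ * 2) fun y => by
      -- The chosen preimage of y has uncontrolled norm; it is traded for one of norm at most 2‖y‖,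
      -- with the same image after applying m and φ.
      obtain ⟨x, hx, hx'⟩ := exists_lift_norm_le φ (Function.surjInv hφ y)
      have h := map_fst_congr hφ m hx
      rw [Function.surjInv_eq hφ y] at hx'
      change ‖φ (m.fst (Function.surjInv hφ y))‖ ≤ _
      rw [← h, mul_assoc]
      exact (NonUnitalStarAlgHom.norm_apply_le φ _).trans ((m.fst.le_opNorm x).trans (by gcongr))

theorem pushFst_apply (m : 𝓜(ℂ, X)) (x : X) : pushFst hφ m (φ x) = φ (m.fst x) :=
  map_fst_congr hφ m (Function.surjInv_eq hφ (φ x))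

/-- The multiplier induced on the target of a surjective `*`-homomorphism. -/
def pushMultiplier (m : 𝓜(ℂ, X)) : 𝓜(ℂ, Y) where
  fst := pushFst hφ m
  -- The right action is y ↦ (m* y*)*, so that the construction and bound for left actions are
  -- reused.
  snd := (((starₗᵢ ℂ : Y ≃ₗᵢ⋆[ℂ] Y) : Y →L⋆[ℂ] Y).comp (pushFst hφ (star m))).comp
    ((starₗᵢ ℂ : Y ≃ₗᵢ⋆[ℂ] Y) : Y →L⋆[ℂ] Y)
  central y z := by
    obtain ⟨x, rfl⟩ := hφ y
    obtain ⟨w, rfl⟩ := hφ z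
    change star (pushFst hφ (star m) (star (φ x))) * φ w = φ x * pushFst hφ m (φ w)
    rw [← map_star φ, pushFst_apply, pushFst_apply, ← map_star φ, star_multiplier_fst, star_star,
      star_star, ← map_mul, ← map_mul, m.central]

theorem pushMultiplier_fst (m : 𝓜(ℂ, X)) (x : X) :
    (pushMultiplier hφ m).fst (φ x) = φ (m.fst x) := pushFst_apply hφ m x

theorem pushMultiplier_snd (m : 𝓜(ℂ, X)) (x : X) :
    (pushMultiplier hφ m).snd (φ x) = φ (m.snd x) := by
  change star (pushFst hφ (star m) (star (φ x))) = _
  rw [← map_star φ, pushFst_apply, ← map_star φ, star_multiplier_fst, star_star, star_star]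

include hφ in
theorem multiplier_ext_of_surjective {m n : 𝓜(ℂ, Y)} (h : ∀ x, m.fst (φ x) = n.fst (φ x)) :
    m = n := multiplier_ext_of_denseRange hφ.denseRange h

/-- The extension `M(X) → M(Y)` of a surjective `*`-homomorphism `X → Y`. -/
def pushHom : 𝓜(ℂ, X) →⋆ₙₐ[ℂ] 𝓜(ℂ, Y) where
  toFun := pushMultiplier hφ
  map_smul' c m := multiplier_ext_of_surjective hφ fun x => by
    change _ = c • (pushMultiplier hφ m).fst (φ x)
    rw [pushMultiplier_fst, pushMultiplier_fst, ← map_smul]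
    rfl
  map_zero' := multiplier_ext_of_surjective hφ fun x => by
    rw [pushMultiplier_fst]
    exact map_zero φ
  map_add' m n := multiplier_ext_of_surjective hφ fun x => by
    change _ = (pushMultiplier hφ m).fst (φ x) + (pushMultiplier hφ n).fst (φ x)
    rw [pushMultiplier_fst, pushMultiplier_fst, pushMultiplier_fst, ← map_add]
    rfl
  map_mul' m n := multiplier_ext_of_surjective hφ fun x => by
    change _ = (pushMultiplier hφ m).fst ((pushMultiplier hφ n).fst (φ x))
    rw [pushMultiplier_fst, pushMultiplier_fst, pushMultiplier_fst]
    rfl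
  map_star' m := multiplier_ext_of_surjective hφ fun x => by
    rw [star_multiplier_fst (pushMultiplier hφ m), pushMultiplier_fst, ← map_star φ,
      pushMultiplier_snd, ← map_star φ, star_multiplier_fst]

theorem pushHom_fst (m : 𝓜(ℂ, X)) (x : X) : (pushHom hφ m).fst (φ x) = φ (m.fst x) :=
  pushMultiplier_fst hφ m x

theorem pushHom_snd (m : 𝓜(ℂ, X)) (x : X) : (pushHom hφ m).snd (φ x) = φ (m.snd x) :=
  pushMultiplier_snd hφ m x

include hφ in
-- A continuous linear map with dense range carries dense subspaces to dense ones. Nondegeneracy and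
-- the density condition of an action pass to quotients in this way.
theorem dense_span_image {s : Set X} {t : Set Y} (hst : φ '' s ⊆ t)
    (hs : (Submodule.span ℂ s).topologicalClosure = ⊤) :
    (Submodule.span ℂ t).topologicalClosure = ⊤ := by
  rw [← Submodule.dense_iff_topologicalClosure_eq_top] at hs ⊢
  have h := hφ.denseRange.dense_image (continuous_starHom φ) hs
  refine h.mono ?_
  have h1 : (φ : X →ₗ[ℂ] Y) '' (Submodule.span ℂ s : Set X) =
      (Submodule.span ℂ ((φ : X →ₗ[ℂ] Y) '' s) : Set Y) := by
    rw [Submodule.span_image, Submodule.map_coe]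
  exact h1.le.trans (Submodule.span_mono hst)

include hφ in
/-- A `*`-homomorphism which vanishes on the kernel of a surjective one factors through it. -/
theorem exists_factor {Z : Type u} [NonUnitalCStarAlgebra Z] (g : X →⋆ₙₐ[ℂ] Z)
    (h : ∀ x, φ x = 0 → g x = 0) : ∃ k : Y →⋆ₙₐ[ℂ] Z, ∀ x, k (φ x) = g x := by
  have hg : ∀ {x x'}, φ x = φ x' → g x = g x' := fun {x x'} e => by
    rw [← sub_eq_zero, ← map_sub]
    exact h _ (by rw [map_sub, e, sub_self])
  refine ⟨{ toFun := fun y => g (Function.surjInv hφ y)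
            map_smul' := fun c y => ?_
            map_zero' := h _ (Function.surjInv_eq hφ 0)
            map_add' := fun y z => ?_
            map_mul' := fun y z => ?_
            map_star' := fun y => ?_ }, fun x => hg (Function.surjInv_eq hφ (φ x))⟩
  · rw [← map_smul]
    exact hg (by simp only [map_smul, Function.surjInv_eq]; rfl)
  · rw [← map_add]
    exact hg (by simp only [map_add, Function.surjInv_eq])
  · rw [← map_mul]
    exact hg (by simp only [map_mul, Function.surjInv_eq])
  · rw [← map_star]
    exact hg (by simp only [map_star, Function.surjInv_eq])

end Push

/-! ### Coassociativity and nondegeneracy pass to quotients -/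

section PushTensor

variable {C A D : Type u} [NonUnitalCStarAlgebra C] [NonUnitalCStarAlgebra A]
  [NonUnitalCStarAlgebra D] {e : A →⋆ₙₐ[ℂ] D} (he : Function.Surjective e)

/-- It suffices to compare the values at c ⊗ e(a) on the vectors c' ⊗ y. As id ⊗ e is onto, y lifts
to C ⊗ A, where the relation between σ and ρ applies. -/
theorem idTensor_mapRight {ρ : A →⋆ₙₐ[ℂ] 𝓜(ℂ, MinTensor C A)} {σ : D →⋆ₙₐ[ℂ] 𝓜(ℂ, MinTensor C D)}
    (h : ∀ a, σ (e a) = pushHom (MinTensor.mapRight_surjective C he) (ρ a)) (x : MinTensor C A) :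
    idTensor σ (MinTensor.mapRight C e x) =
      pushHom (MinTensor₃.mapRight_surjective C C he) (idTensor ρ x) := by
  refine DFunLike.congr_fun (MinTensor.hom_ext (f := (idTensor σ).comp (MinTensor.mapRight C e))
    (g := (pushHom (MinTensor₃.mapRight_surjective C C he)).comp (idTensor ρ)) fun c a => ?_) x
  rw [NonUnitalStarAlgHom.comp_apply, NonUnitalStarAlgHom.comp_apply, MinTensor.mapRight_inc,
    mapRightAlg_tmul]
  refine multiplier_ext_of_denseRange (modelRight C C D).dense fun w => ?_
  induction w with
  | zero => simp
  | add x y hx hy => simp only [map_add, hx, hy]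
  | tmul c' y =>
    obtain ⟨y, rfl⟩ := MinTensor.mapRight_surjective C he y
    have hs : ∀ c y, (modelRight C C D).toFun (c ⊗ₜ MinTensor.mapRight C e y) =
      MinTensor₃.mapRight C C e ((modelRight C C A).toFun (c ⊗ₜ y)) := fun c y =>
      (mapRight_mulRight₃ e c y).symm
    rw [idTensor, SpatialModel.tensorHom_tmul, h, pushHom_fst, hs, hs, pushHom_fst, idTensor,
      SpatialModel.tensorHom_tmul]

/-- Here e touches only the last leg, on which both sides act by left multiplication, so
multiplicativity of e is the whole point. -/
theorem tensorId_mapRight (Δ : C →⋆ₙₐ[ℂ] 𝓜(ℂ, MinTensor C C)) (x : MinTensor C A) :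
    tensorId D Δ (MinTensor.mapRight C e x) =
      pushHom (MinTensor₃.mapRight_surjective C C he) (tensorId A Δ x) := by
  refine DFunLike.congr_fun (MinTensor.hom_ext (f := (tensorId D Δ).comp (MinTensor.mapRight C e))
    (g := (pushHom (MinTensor₃.mapRight_surjective C C he)).comp (tensorId A Δ)) fun c a => ?_) x
  rw [NonUnitalStarAlgHom.comp_apply, NonUnitalStarAlgHom.comp_apply, MinTensor.mapRight_inc,
    mapRightAlg_tmul]
  refine multiplier_ext_of_denseRange (modelLeft C C D).dense fun w => ?_
  induction w with
  | zero => simp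
  | add x y hx hy => simp only [map_add, hx, hy]
  | tmul t d =>
    obtain ⟨d, rfl⟩ := he d
    have hs : ∀ t d, (modelLeft C C D).toFun (t ⊗ₜ e d) =
      MinTensor₃.mapRight C C e ((modelLeft C C A).toFun (t ⊗ₜ d)) := fun t d =>
      (mapRight_mulLeft₃ e t d).symm
    rw [tensorId, SpatialModel.tensorHom_tmul, hs, pushHom_fst, tensorId,
      SpatialModel.tensorHom_tmul, toMultiplier_fst, toMultiplier_fst, ← map_mul, hs]

/-- Extensions to multipliers pass to quotients. -/
theorem IsMultiplierExtension.push {X Y X' Y' : Type u} [NonUnitalCStarAlgebra X]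
    [NonUnitalCStarAlgebra Y] [NonUnitalCStarAlgebra X'] [NonUnitalCStarAlgebra Y']
    {φ : X →⋆ₙₐ[ℂ] X'} (hφ : Function.Surjective φ) {ψ : Y →⋆ₙₐ[ℂ] Y'}
    (hψ : Function.Surjective ψ) {g : X →⋆ₙₐ[ℂ] 𝓜(ℂ, Y)} {g' : X' →⋆ₙₐ[ℂ] 𝓜(ℂ, Y')}
    (hg : ∀ x, g' (φ x) = pushHom hψ (g x)) {m : 𝓜(ℂ, X)} {n : 𝓜(ℂ, Y)}
    (h : IsMultiplierExtension g m n) :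
    IsMultiplierExtension g' (pushHom hφ m) (pushHom hψ n) := fun x => by
  obtain ⟨x, rfl⟩ := hφ x
  rw [pushHom_fst, pushHom_snd, hg, hg, hg, ← map_mul, ← map_mul, (h x).1, (h x).2]
  exact ⟨rfl, rfl⟩

/-- The common value T of (id ⊗ ρ)ρ(a) and (Δ ⊗ id)ρ(a) is pushed along id ⊗ id ⊗ e and serves as
the common value at e(a). -/
theorem Coassociative.push {Δ : C →⋆ₙₐ[ℂ] 𝓜(ℂ, MinTensor C C)}
    {ρ : A →⋆ₙₐ[ℂ] 𝓜(ℂ, MinTensor C A)} {σ : D →⋆ₙₐ[ℂ] 𝓜(ℂ, MinTensor C D)}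
    (h : ∀ a, σ (e a) = pushHom (MinTensor.mapRight_surjective C he) (ρ a))
    (hρ : Coassociative Δ ρ) : Coassociative Δ σ := fun d => by
  obtain ⟨a, rfl⟩ := he d
  obtain ⟨T, h1, h2⟩ := hρ a
  refine ⟨pushHom (MinTensor₃.mapRight_surjective C C he) T, ?_, ?_⟩
  · rw [h]
    exact h1.push _ _ (idTensor_mapRight he h)
  · rw [h]
    exact h2.push _ _ (tensorId_mapRight he Δ)

theorem Nondegenerate.push {X Y Y' : Type u} [NonUnitalCStarAlgebra X] [NonUnitalCStarAlgebra Y]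
    [NonUnitalCStarAlgebra Y'] {ψ : Y →⋆ₙₐ[ℂ] Y'} (hψ : Function.Surjective ψ)
    {Z : Type u} [NonUnitalCStarAlgebra Z] {φ : X →⋆ₙₐ[ℂ] Z} {g : X →⋆ₙₐ[ℂ] 𝓜(ℂ, Y)}
    {g' : Z →⋆ₙₐ[ℂ] 𝓜(ℂ, Y')} (hg : ∀ x, g' (φ x) = pushHom hψ (g x)) (h : Nondegenerate g) :
    Nondegenerate g' := by
  refine ⟨dense_span_image hψ ?_ h.1, dense_span_image hψ ?_ h.2⟩
  · rintro _ ⟨_, ⟨x, y, rfl⟩, rfl⟩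
    exact ⟨φ x, ψ y, by rw [hg, pushHom_fst]⟩
  · rintro _ ⟨_, ⟨x, y, rfl⟩, rfl⟩
    exact ⟨φ x, ψ y, by rw [hg, pushHom_snd]⟩

end PushTensor

/-! ### Actions on quotients and images -/

section Actions

variable {G : LCQG.{u}} {A B D : Type u} [CStarAlgebra A] [CStarAlgebra B] [CStarAlgebra D]

/-- A quotient of an algebra with an action, by an invariant ideal, carries an action. -/
theorem exists_action_of_surjective (ρ : Action G A) {e : A →⋆ₐ[ℂ] D}
    (he : Function.Surjective (e : A →⋆ₙₐ[ℂ] D))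
    (h : ∀ a, e a = 0 → pushHom (MinTensor.mapRight_surjective G.Carrier he) (ρ.toHom a) = 0) :
    ∃ σ : Action G D, Equivariant ρ σ e := by
  obtain ⟨k, hk⟩ := exists_factor he
    ((pushHom (MinTensor.mapRight_surjective G.Carrier he)).comp ρ.toHom) h
  have hk' : ∀ a, k ((e : A →⋆ₙₐ[ℂ] D) a) =
    pushHom (MinTensor.mapRight_surjective G.Carrier he) (ρ.toHom a) := hk
  refine ⟨⟨k, ρ.nondegenerate.push _ hk', ρ.coassoc.push he hk', ?_⟩, fun a => ?_⟩
  · refine dense_span_image (MinTensor.mapRight_surjective G.Carrier he) ?_ ρ.continuous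
    rintro _ ⟨_, ⟨a, c, rfl⟩, rfl⟩
    refine ⟨e a, c, ?_⟩
    -- Unitality of e enters here: c ⊗ 1 goes to c ⊗ 1, so the generators ρ(a)(c ⊗ 1) map to
    -- generators of the same form for D.
    have h1 : MinTensor.mapRight G.Carrier (e : A →⋆ₙₐ[ℂ] D) (MinTensor.inc (c ⊗ₜ 1)) =
        MinTensor.inc (c ⊗ₜ 1) := by
      rw [MinTensor.mapRight_inc, mapRightAlg_tmul]
      exact congrArg (fun d => MinTensor.inc (c ⊗ₜ d)) (map_one e)
    rw [← h1, ← pushHom_fst (MinTensor.mapRight_surjective G.Carrier he), ← hk']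
    rfl
  · refine (isMultiplierExtension_comp_iff _ _ _).2 fun x => ?_
    have h1 : k (e a) = _ := hk' a
    change (k (e a)).fst _ = _ ∧ (k (e a)).snd _ = _
    rw [h1]
    exact ⟨pushHom_fst _ _ _, pushHom_snd _ _ _⟩

theorem Equivariant.fst {ρ : Action G A} {σ : Action G B} {f : A →⋆ₐ[ℂ] B}
    (h : Equivariant ρ σ f) (a : A) (x : MinTensor G.Carrier A) :
    (σ.toHom (f a)).fst (MinTensor.mapRight G.Carrier (f : A →⋆ₙₐ[ℂ] B) x) =
      MinTensor.mapRight G.Carrier (f : A →⋆ₙₐ[ℂ] B) ((ρ.toHom a).fst x) :=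
  ((isMultiplierExtension_comp_iff _ _ _).1 (h a) x).1

theorem Equivariant.snd {ρ : Action G A} {σ : Action G B} {f : A →⋆ₐ[ℂ] B}
    (h : Equivariant ρ σ f) (a : A) (x : MinTensor G.Carrier A) :
    (σ.toHom (f a)).snd (MinTensor.mapRight G.Carrier (f : A →⋆ₙₐ[ℂ] B) x) =
      MinTensor.mapRight G.Carrier (f : A →⋆ₙₐ[ℂ] B) ((ρ.toHom a).snd x) :=
  ((isMultiplierExtension_comp_iff _ _ _).1 (h a) x).2

theorem mapRight_comp_apply (C : Type u) [NonUnitalCStarAlgebra C] (g : D →⋆ₐ[ℂ] B)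
    (f : A →⋆ₐ[ℂ] D) (x : MinTensor C A) :
    MinTensor.mapRight C ((g.comp f : A →⋆ₐ[ℂ] B) : A →⋆ₙₐ[ℂ] B) x =
      MinTensor.mapRight C (g : D →⋆ₙₐ[ℂ] B) (MinTensor.mapRight C (f : A →⋆ₙₐ[ℂ] D) x) :=
  DFunLike.congr_fun (MinTensor.mapRight_comp (g : D →⋆ₙₐ[ℂ] B) (f : A →⋆ₙₐ[ℂ] D)) x

/-- Equivariance descends along surjections. -/
theorem Equivariant.of_comp {ρ : Action G A} {σ : Action G D} {τ : Action G B} {g : D →⋆ₐ[ℂ] B}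
    {e : A →⋆ₐ[ℂ] D} (he : Function.Surjective e) (h : Equivariant ρ σ e)
    (hg : Equivariant ρ τ (g.comp e)) : Equivariant σ τ g := fun d => by
  obtain ⟨a, rfl⟩ := he d
  refine (isMultiplierExtension_comp_iff _ _ _).2 fun y => ?_
  -- Equivariance of g is tested on elements of C ⊗ D. Each of them lifts to C ⊗ A, where the claim
  -- becomes equivariance of g ∘ e.
  obtain ⟨x, rfl⟩ := MinTensor.mapRight_surjective G.Carrier
    (e := (e : A →⋆ₙₐ[ℂ] D)) he y
  rw [h.fst, h.snd, ← mapRight_comp_apply, ← mapRight_comp_apply, ← mapRight_comp_apply]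
  exact ⟨hg.fst a x, hg.snd a x⟩

/-- An action is determined by the equivariance of a surjection onto the algebra acted upon. -/
theorem Equivariant.action_unique {ρ : Action G A} {σ σ' : Action G D} {e : A →⋆ₐ[ℂ] D}
    (he : Function.Surjective e) (h : Equivariant ρ σ e) (h' : Equivariant ρ σ' e) : σ = σ' := by
  refine Action.ext (NonUnitalStarAlgHom.ext fun d => ?_)
  obtain ⟨a, rfl⟩ := he d
  exact multiplier_ext_of_surjective (MinTensor.mapRight_surjective G.Carrier
    (e := (e : A →⋆ₙₐ[ℂ] D)) he) fun x => (h.fst a x).trans (h'.fst a x).symm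

/-- The image of an equivariant `*`-homomorphism carries an action. -/
theorem Equivariant.exists_action_image {ρ : Action G A} {τ : Action G B} {e : A →⋆ₐ[ℂ] D}
    {i : D →⋆ₐ[ℂ] B} (he : Function.Surjective e) (hi : Function.Injective i)
    (h : Equivariant ρ τ (i.comp e)) :
    ∃ σ : Action G D, Equivariant ρ σ e ∧ Equivariant σ τ i := by
  have he' : Function.Surjective (e : A →⋆ₙₐ[ℂ] D) := he
  -- For a in ker e, the image of the pushed multiplier's values under the injective map id ⊗ i is
  -- τ(i(e(a))) (id ⊗ i e)(x) = 0, so the pushed multiplier vanishes.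
  obtain ⟨σ, hσ⟩ := exists_action_of_surjective ρ he' fun a ha => by
    refine multiplier_ext_of_surjective (MinTensor.mapRight_surjective G.Carrier he') fun x => ?_
    refine MinTensor.mapRight_injective G.Carrier (f := (i : D →⋆ₙₐ[ℂ] B)) hi ?_
    rw [pushHom_fst, ← mapRight_comp_apply, ← h.fst, StarAlgHom.comp_apply, ha, map_zero, map_zero]
    exact (map_zero (MinTensor.mapRight G.Carrier (i : D →⋆ₙₐ[ℂ] B))).symm
  exact ⟨σ, hσ, .of_comp he hσ h⟩

theorem isClosed_range_starAlgHom (f : A →⋆ₐ[ℂ] B) : IsClosed (f.range : Set B) := by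
  have h := isClosed_range_starHom (f : A →⋆ₙₐ[ℂ] B)
  exact h

end Actions

/-! ### The factorization system -/

section Category

open CategoryTheory

variable {G : LCQG.{u}}

theorem GCStar.hom_comp_apply {A B D : GCStar G} (f : A ⟶ B) (g : B ⟶ D) (a : A.Carrier) :
    (f ≫ g).toHom a = g.toHom (f.toHom a) := rfl

theorem GCStar.hom_ext {A B : GCStar G} {f g : A ⟶ B} (h : ∀ a, f.toHom a = g.toHom a) : f = g :=
  Hom.ext (StarAlgHom.ext h)

theorem GCStar.hom_inv_apply {A B : GCStar G} (h : A ≅ B) (a : A.Carrier) :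
    h.inv.toHom (h.hom.toHom a) = a := by
  rw [← hom_comp_apply, h.hom_inv_id]
  rfl

theorem GCStar.inv_hom_apply {A B : GCStar G} (h : A ≅ B) (b : B.Carrier) :
    h.hom.toHom (h.inv.toHom b) = b := by
  rw [← hom_comp_apply, h.inv_hom_id]
  rfl

/-- Diagonal filling of a surjection against an injection. -/
theorem GCStar.exists_fill {X Y Z₁ Z₂ : GCStar G} {e₁ : X ⟶ Z₁} {m₁ : Z₁ ⟶ Y} {e₂ : X ⟶ Z₂}
    {m₂ : Z₂ ⟶ Y} (he₁ : Function.Surjective e₁.toHom) (hm₂ : Function.Injective m₂.toHom)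
    (h : e₁ ≫ m₁ = e₂ ≫ m₂) : ∃ k : Z₁ ⟶ Z₂, e₁ ≫ k = e₂ ∧ k ≫ m₂ = m₁ := by
  have h' : ∀ x, m₁.toHom (e₁.toHom x) = m₂.toHom (e₂.toHom x) := fun x => by
    rw [← hom_comp_apply, h, hom_comp_apply]
  -- The kernel of e₁ lies in that of e₂, since m₂ e₂ = m₁ e₁ and m₂ is injective.
  obtain ⟨k, hk⟩ := exists_factor (φ := (e₁.toHom : X.Carrier →⋆ₙₐ[ℂ] Z₁.Carrier)) he₁
    (e₂.toHom : X.Carrier →⋆ₙₐ[ℂ] Z₂.Carrier) fun x hx => hm₂ (by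
      change m₂.toHom (e₂.toHom x) = _
      rw [← h', map_zero, show e₁.toHom x = 0 from hx, map_zero])
  have hk' : ∀ x, k (e₁.toHom x) = e₂.toHom x := hk
  have h1 : k 1 = 1 := by rw [← map_one e₁.toHom, hk', map_one]
  let K : Z₁.Carrier →⋆ₐ[ℂ] Z₂.Carrier :=
    { toFun := k
      map_one' := h1
      map_mul' := map_mul k
      map_zero' := map_zero k
      map_add' := map_add k
      commutes' := fun r => by
        rw [Algebra.algebraMap_eq_smul_one, Algebra.algebraMap_eq_smul_one, map_smul, h1]
      map_star' := map_star k }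
  have hK : K.comp e₁.toHom = e₂.toHom := StarAlgHom.ext hk'
  -- Equivariance of the filling is automatic: its composite with the surjection e₁ is the
  -- equivariant map e₂.
  refine ⟨⟨K, .of_comp he₁ e₁.equivariant (hK ▸ e₂.equivariant)⟩, hom_ext hk', hom_ext fun z => ?_⟩
  obtain ⟨x, rfl⟩ := he₁ z
  change m₂.toHom (k (e₁.toHom x)) = _
  rw [hk', h']

theorem GCStar.isFactorizationSystem (G : LCQG.{u}) :
    IsFactorizationSystem (surjections G) (injections G) where
  left_comp := ⟨fun _ _ hf hg => hg.comp hf⟩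
  right_comp := ⟨fun _ _ hf hg => hg.comp hf⟩
  left_iso _ _ f hf b := by
    have : IsIso f := hf
    exact ⟨_, inv_hom_apply (asIso f) b⟩
  right_iso _ _ f hf := by
    have : IsIso f := hf
    exact Function.LeftInverse.injective (hom_inv_apply (asIso f))
  exists_factorization {X Y} f := by
    -- Closedness is the instance that makes the range a C⋆-algebra.
    have := isClosed_range_starAlgHom f.toHom
    obtain ⟨σ, h1, h2⟩ := Equivariant.exists_action_image (ρ := X.action) (τ := Y.action)
      (e := f.toHom.rangeRestrict) (i := f.toHom.range.subtype)
      f.toHom.rangeRestrict_surjective Subtype.val_injective f.equivariant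
    exact ⟨⟨f.toHom.range, σ⟩, ⟨f.toHom.rangeRestrict, h1⟩, ⟨f.toHom.range.subtype, h2⟩,
      f.toHom.rangeRestrict_surjective, Subtype.val_injective, rfl⟩
  unique_factorization {X Y Z₁ Z₂} e₁ m₁ e₂ m₂ he₁ hm₁ he₂ hm₂ h := by
    obtain ⟨k, hk, hk'⟩ := exists_fill he₁ hm₂ h
    obtain ⟨l, hl, hl'⟩ := exists_fill he₂ hm₁ h.symm
    -- The fillings in the two directions are mutually inverse, as seen after composing with the
    -- injections: m₁ l k = m₂ k = m₁, and symmetrically. Uniqueness holds because e₁ is onto.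
    refine ⟨⟨k, l, hom_ext fun z => hm₁ ?_, hom_ext fun z => hm₂ ?_⟩, ⟨hk, hk'⟩, fun j hj => ?_⟩
    · rw [← hom_comp_apply, Category.assoc, hl', hk']
      rfl
    · rw [← hom_comp_apply, Category.assoc, hk', hl']
      rfl
    · refine Iso.ext (hom_ext fun z => ?_)
      obtain ⟨x, rfl⟩ := he₁ z
      rw [← hom_comp_apply, ← hom_comp_apply, hj.1, hk]

end Category

end QG

end

/-- Closedness is stated as an existential because its proof supplies the C⋆-algebra structure on
the range without which an action on it cannot be formulated. -/
theorem mainTheorem11 (G : QG.LCQG.{u}) :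
    QG.IsFactorizationSystem (QG.GCStar.surjections G) (QG.GCStar.injections G) ∧
    ∀ (A B : QG.GCStar G) (f : QG.GCStar.Hom A B),
      ∃ _ : IsClosed (f.toHom.range : Set B.Carrier),
        ∃! ρ : QG.Action G f.toHom.range,
          QG.Equivariant A.action ρ f.toHom.rangeRestrict ∧
          QG.Equivariant ρ B.action f.toHom.range.subtype := by
  refine ⟨QG.GCStar.isFactorizationSystem G, fun A B f => ?_⟩
  refine ⟨QG.isClosed_range_starAlgHom f.toHom, ?_⟩
  have := QG.isClosed_range_starAlgHom f.toHom
  obtain ⟨σ, h1, h2⟩ := QG.Equivariant.exists_action_image (ρ := A.action) (τ := B.action)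
    (e := f.toHom.rangeRestrict) (i := f.toHom.range.subtype)
    f.toHom.rangeRestrict_surjective Subtype.val_injective f.equivariant
  -- Equivariance of the surjection A → f(A) alone already pins down the action.
  exact ⟨σ, ⟨h1, h2⟩, fun σ' h' => h'.1.action_unique f.toHom.rangeRestrict_surjective h1⟩
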